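/- **Signed graphs.** A signed graph $\Sigma$ has vertex set $[n]$, a finite family $E$ of edges (multiple edges allowed) and a sign $\epsilon(e)\in\{+1,-1\}$ for each edge. An edge has two ends (at distinct vertices, or at the same vertex: a loop), one end (a half-edge), or no end (a free loop). A proper coloring is a map $\sigma:V\to\mathbb Z$ with $\sigma(i)\neq\epsilon(e)\sigma(j)$ for each edge $e$ with two ends, at $i$ and $j$ (possibly $i=j$), and $\sigma(i)\ne 0$ for each half-edge at $i$; there is none if $\Sigma$ has a free loop. $\chi_\Sigma$ is the polynomial such that, for every $k\in\mathbb N$, $\chi_\Sigma(k)$ is the number of proper colorings with values in $[-k,k]$. **Acyclic orientations.** An orientation of $\Sigma$ assigns $\tau=\pm1$ to each edge end so that $\tau(e,i)=-\epsilon(e)\tau(e,j)$ for the two ends (at $i$ and $j$) of each two-ended edge. A circle is the edge set of a simple closed path (a loop is a circle of length $1$), and its sign is the product of the signs of its edges. A circuit is a free loop, a positive circle, or a handcuff, that is, either two edge-disjoint figures, each a negative circle or a half-edge, with exactly one common vertex, or two vertex-disjoint such figures together with a simple path that joins them and meets each of them in an end point only. The orientation is acyclic if no circuit $C$ is a cycle,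 that is, if every circuit $C$ has a vertex at which all ends of edges of $C$ have the same sign $\tau$. **Automorphisms.** A signed permutation $\beta=(b,\delta)$ consists of $b\in S_n$ and $\delta\subseteq[n]$ and acts on $\mathbb R^n$ by $e_i\mapsto(-1)^{|\delta\cap\{b(i)\}|}e_{b(i)}$. It maps an edge $e$ to an edge $e'$ whose ends are at the images under $b$ of the vertices of the ends of $e$, with $\epsilon(e')=(-1)^{m}\epsilon(e)$, where $m$ is the number of ends of $e'$ at vertices in $\delta$ (both ends of a loop count). $B$ is the group of all signed permutations that map the edge multiset of $\Sigma$ to itself. An automorphism carries an orientation to the one in which the image of an end with sign $\tau$ at $i$ has the sign $(-1)^{|\delta\cap\{b(i)\}|}\tau$ at $b(i)$. Two acyclic orientations agree up to automorphism if some automorphism, together with some induced bijections of the edges and of the edge ends, carries one to the other; $\hat\Delta$ is the set of classes. **Quotients.** The vertices of $\Sigma/\beta$ are the cycles $C_s$ of $b$ (fixed points included) with $|C_s\cap\delta|$ even. Each edge $e$ of $\Sigma$ gives one edge $e'$ of $\Sigma/\beta$: an end of $e$ at $i\in C_s$ becomes an end at $s$ if $s\in V(\Sigma/\beta)$, and is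 deleted otherwise. If an end is deleted, then $\epsilon(e')=-1$. If $e$ has two ends, at $i$ and $j$, and both remain, then $\epsilon(e')=\epsilon(e)(-1)^{\beta_{(i)}+\beta_{(j)}}$, where $\beta_{(i)}=|\delta\cap\{b(k),b^2(k),\dots,b^l(k)=i\}|$, $k$ is the minimal element of the cycle of $i$, and $l$ is the smallest positive integer with $b^l(k)=i$. Otherwise $\epsilon(e')=\epsilon(e)$. **Theorem.** For every signed graph $\Sigma$ with signed-automorphism group $B$, the polynomials $\chi_{\Sigma/\beta}$ $(\beta\in B)$ exist, and the number of acyclic orientations of $\Sigma$ up to automorphism is $$|\hat\Delta|=\frac1{|B|}\sum_{\beta\in B}(-1)^{|V(\Sigma/\beta)|}\,\chi_{\Sigma/\beta}(-1).$$ -/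

import Mathlib

open Polynomial

/-! ### Signed permutations -/

/-- A signed permutation of `[n]`, written as a pair `(b, δ)` of a permutation and a switching set.
It acts on `ℝⁿ` by `e_i ↦ (-1)^{|δ ∩ {b i}|} e_{b i}`. -/
@[ext]
structure SignedPerm (n : ℕ) where
  perm : Equiv.Perm (Fin n)
  switch : Set (Fin n)

namespace SignedPerm

variable {n : ℕ}

/-- The sign `(-1)^{|δ ∩ {i}|}`. -/
noncomputable def sgn (β : SignedPerm n) (i : Fin n) : ℤˣ := by
  classical exact if i ∈ β.switch then -1 else 1

theorem sgn_ext {β γ : SignedPerm n} (hp : β.perm = γ.perm) (hs : ∀ i, β.sgn i = γ.sgn i) :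
    β = γ := by
  refine SignedPerm.ext hp (Set.ext fun i => ?_)
  have h := hs i
  have h1 : (-1 : ℤˣ) ≠ 1 := by decide
  unfold sgn at h
  split_ifs at h with h2 h3 h3
  · simp [h2, h3]
  · exact absurd h h1
  · exact absurd h.symm h1
  · simp [h2, h3]

noncomputable instance : Fintype (SignedPerm n) := by
  classical
  exact Fintype.ofInjective (fun β : SignedPerm n => (β.perm, β.switch))
    (fun _ _ h => SignedPerm.ext (Prod.ext_iff.1 h).1 (Prod.ext_iff.1 h).2)

instance : One (SignedPerm n) := ⟨⟨1, ∅⟩⟩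

/-- Composition of signed permutations, as linear maps of `ℝⁿ`: the coordinate sign of `β * γ` at
`i` is the product of the sign of `β` at `i` and the sign of `γ` at `b⁻¹ i`. -/
instance : Mul (SignedPerm n) :=
  ⟨fun β γ => ⟨β.perm * γ.perm, symmDiff β.switch {i | β.perm.symm i ∈ γ.switch}⟩⟩

instance : Inv (SignedPerm n) := ⟨fun β => ⟨β.perm⁻¹, {i | β.perm i ∈ β.switch}⟩⟩

@[simp] theorem perm_one : (1 : SignedPerm n).perm = 1 := rfl
@[simp] theorem perm_mul (β γ : SignedPerm n) : (β * γ).perm = β.perm * γ.perm := rfl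
@[simp] theorem perm_inv (β : SignedPerm n) : (β⁻¹).perm = β.perm⁻¹ := rfl

@[simp] theorem sgn_one (i : Fin n) : (1 : SignedPerm n).sgn i = 1 := by
  have h : i ∉ (1 : SignedPerm n).switch := fun h => h
  simp [sgn, h]

@[simp] theorem sgn_mul (β γ : SignedPerm n) (i : Fin n) :
    (β * γ).sgn i = β.sgn i * γ.sgn (β.perm.symm i) := by
  have h : i ∈ (β * γ).switch ↔
      i ∈ β.switch ∧ β.perm.symm i ∉ γ.switch ∨ β.perm.symm i ∈ γ.switch ∧ i ∉ β.switch := Iff.rfl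
  by_cases h1 : i ∈ β.switch <;> by_cases h2 : β.perm.symm i ∈ γ.switch <;>
    simp [sgn, h, h1, h2]

@[simp] theorem sgn_inv (β : SignedPerm n) (i : Fin n) : (β⁻¹).sgn i = β.sgn (β.perm i) := rfl

theorem sgn_mul_self (β : SignedPerm n) (i : Fin n) : β.sgn i * β.sgn i = 1 :=
  Int.units_mul_self _

/-- The hyperoctahedral group. -/
instance : Group (SignedPerm n) :=
  Group.ofLeftAxioms
    (fun a b c => sgn_ext (by simp [mul_assoc]) (fun i => by simp [mul_assoc]; rfl))
    (fun a => sgn_ext (by simp) (fun i => by simp; rfl))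
    (fun a => sgn_ext (by simp) (fun i => by
      simp only [sgn_mul, sgn_inv, perm_inv, sgn_one]
      exact sgn_mul_self _ _))

/-- The smallest element of the `b`-cycle of `i`. -/
noncomputable def cycleMin (β : SignedPerm n) (i : Fin n) : Fin n := by
  classical
  exact (Finset.univ.filter fun j => β.perm.SameCycle j i).min'
    ⟨i, Finset.mem_filter.2 ⟨Finset.mem_univ i, Equiv.Perm.SameCycle.refl _ _⟩⟩

/-- The number `β_(i) = |δ ∩ {b k, b² k, …, b^l k = i}|`, where `k` is the smallest element of the
`b`-cycle of `i` and `l` is the smallest positive integer with `b^l k = i`. -/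
noncomputable def cycleIndex (β : SignedPerm n) (i : Fin n) : ℕ :=
  (β.switch ∩ {j | ∃ t, 1 ≤ t ∧ t ≤ sInf {l : ℕ | 0 < l ∧ (β.perm ^ l) (β.cycleMin i) = i} ∧
    (β.perm ^ t) (β.cycleMin i) = j}).ncard

/-- The cycles of `b`, fixed points included. -/
abbrev Cycle (β : SignedPerm n) : Type := Quotient (Equiv.Perm.SameCycle.setoid β.perm)

/-- The cycle of `b` through `i`. -/
def cycleOf (β : SignedPerm n) (i : Fin n) : β.Cycle := Quotient.mk _ i

/-- The cycles of `b` that meet `δ` in an even number of elements. -/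
def EvenCycle (β : SignedPerm n) : Type :=
  {s : β.Cycle // Even {i | i ∈ β.switch ∧ β.cycleOf i = s}.ncard}

end SignedPerm

/-! ### Signed graphs, colorings -/

/-- A signed graph on the vertex set `V`, with edges indexed by `E` (so that multiple edges are
allowed). `I` indexes the incidences (edge ends): the incidence `a` is an end of the edge `edge a`
at the vertex `vert a`, and an edge has at most two ends. An edge with two ends at distinct vertices
is a link, an edge with two ends at the same vertex is a loop, an edge with exactly one end is a
half-edge, and an edge with no ends is a free loop. -/
structure SignedGraph (V E I : Type*) where
  edge : I → E
  vert : I → V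
  sign : E → ℤˣ
  encard_ends_le : ∀ e, {a | edge a = e}.encard ≤ 2

namespace SignedGraph

section General

variable {V E I : Type*} (G : SignedGraph V E I)

/-- The set of ends of an edge. -/
def ends (e : E) : Set I := {a | G.edge a = e}

/-- Proper colorings: no edge is a free loop; the color at the end of a half-edge is not `0`;
and `c(i) ≠ ε(e) c(j)` for an edge `e` with two ends, at `i` and `j`. For a loop (`i = j`) the last
condition says `c(i) ≠ 0` if the loop is negative, and is impossible if it is positive. -/
def IsProper (c : V → ℤ) : Prop :=
  (∀ e, (G.ends e).Nonempty) ∧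
  (∀ a, G.ends (G.edge a) = {a} → c (G.vert a) ≠ 0) ∧
  (∀ a a', a ≠ a' → G.edge a = G.edge a' →
    c (G.vert a) ≠ (G.sign (G.edge a) : ℤ) * c (G.vert a'))

/-- The number of proper colorings with values in `[-k, k]`. -/
noncomputable def numProperColorings (k : ℕ) : ℕ :=
  Nat.card {c : V → ℤ // (∀ v, -(k : ℤ) ≤ c v ∧ c v ≤ k) ∧ G.IsProper c}

open Classical in
/-- The signed chromatic polynomial: the polynomial whose value at every natural number `k` is the
number of proper colorings with values in `[-k, k]` (and `0` should there be no such polynomial). -/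
noncomputable def chromaticPolynomial : ℚ[X] :=
  if h : ∃ p : ℚ[X], ∀ k : ℕ, p.eval (k : ℚ) = G.numProperColorings k then h.choose else 0

/-! ### Circuits -/

/-- The vertices that meet a set of edges. -/
def verts (C : Set E) : Set V := {v | ∃ a, G.edge a ∈ C ∧ G.vert a = v}

/-- The number of ends at `v` of the edges in `C`; loops count twice. -/
noncomputable def degIn (C : Set E) (v : V) : ℕ := {a | G.edge a ∈ C ∧ G.vert a = v}.ncard

/-- A set of edges is connected if it is not the union of two nonempty parts without a common
vertex. -/
def ConnectedEdges (C : Set E) : Prop :=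
  ∀ D ⊆ C, D.Nonempty → (C \ D).Nonempty → (G.verts D ∩ G.verts (C \ D)).Nonempty

/-- A circle: the edge set of a simple closed path (a loop is a circle of length one). -/
def IsCircle (C : Set E) : Prop :=
  C.Nonempty ∧ G.ConnectedEdges C ∧ (∀ e ∈ C, (G.ends e).encard = 2) ∧
  ∀ v ∈ G.verts C, G.degIn C v = 2

/-- The product of the signs of the edges in a (finite) set. -/
noncomputable def signProd (C : Set E) : ℤˣ := ∏ᶠ e ∈ C, G.sign e

/-- The edge set of a simple path of positive length with end points `u ≠ v`. -/
def IsPath (P : Set E) (u v : V) : Prop :=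
  u ≠ v ∧ G.ConnectedEdges P ∧ (∀ e ∈ P, (G.ends e).encard = 2) ∧
  G.degIn P u = 1 ∧ G.degIn P v = 1 ∧ ∀ w ∈ G.verts P, w ≠ u → w ≠ v → G.degIn P w = 2

/-- A negative circle or a half-edge. -/
def IsUnbalancedFigure (C : Set E) : Prop :=
  (G.IsCircle C ∧ G.signProd C = -1) ∨ ∃ e, C = {e} ∧ (G.ends e).encard = 1

/-- Two edge-disjoint unbalanced figures with exactly one common vertex. -/
def IsTightHandcuff (C : Set E) : Prop :=
  ∃ C₁ C₂, C = C₁ ∪ C₂ ∧ Disjoint C₁ C₂ ∧ G.IsUnbalancedFigure C₁ ∧ G.IsUnbalancedFigure C₂ ∧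
    ∃ v, G.verts C₁ ∩ G.verts C₂ = {v}

/-- Two vertex-disjoint unbalanced figures and a simple path that joins them and meets each of them
in an end point only. -/
def IsLooseHandcuff (C : Set E) : Prop :=
  ∃ C₁ C₂ P u v, C = C₁ ∪ C₂ ∪ P ∧ G.IsUnbalancedFigure C₁ ∧ G.IsUnbalancedFigure C₂ ∧
    Disjoint (G.verts C₁) (G.verts C₂) ∧ G.IsPath P u v ∧
    G.verts P ∩ G.verts C₁ = {u} ∧ G.verts P ∩ G.verts C₂ = {v}

/-- The circuits of a signed graph: a free loop, a positive circle, or a handcuff. -/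
def IsCircuit (C : Set E) : Prop :=
  (∃ e, C = {e} ∧ G.ends e = ∅) ∨ (G.IsCircle C ∧ G.signProd C = 1) ∨
  G.IsTightHandcuff C ∨ G.IsLooseHandcuff C

/-! ### Orientations -/

/-- An orientation of a signed graph: a sign for each incidence, with `τ(e,i) = -ε(e) τ(e,j)` for
the two ends of an edge. -/
@[ext]
structure Orientation where
  τ : I → ℤˣ
  compat : ∀ a a', a ≠ a' → G.edge a = G.edge a' → τ a = -G.sign (G.edge a) * τ a'

variable {G}

/-- A cycle of an oriented signed graph: a circuit in which no vertex is a source or a sink. -/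
def Orientation.IsCycle (o : G.Orientation) (C : Set E) : Prop :=
  G.IsCircuit C ∧ ∀ v ∈ G.verts C,
    (∃ a, G.edge a ∈ C ∧ G.vert a = v ∧ o.τ a = 1) ∧
    (∃ a, G.edge a ∈ C ∧ G.vert a = v ∧ o.τ a = -1)

/-- An orientation is acyclic if it has no cycles. -/
def Orientation.IsAcyclic (o : G.Orientation) : Prop := ∀ C, ¬ o.IsCycle C

variable (G)

/-- The set `Δ` of acyclic orientations. -/
def AcyclicOrientation : Type _ := {o : G.Orientation // o.IsAcyclic}

end General

/-! ### Automorphisms -/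

variable {n : ℕ} {E I : Type*} (G : SignedGraph (Fin n) E I)

/-- The bijections `f` of the edges and `g` of the incidences realize the invariance of `G` under
the signed permutation `β = (b, δ)`: the ends of `f e` are the images under `b` of the ends of `e`,
and `ε(f e) = (-1)^{|f e ∩ δ|} ε(e)`, where `|f e ∩ δ|` is the number of ends of `f e` in `δ`. -/
structure Realizes (β : SignedPerm n) (f : E ≃ E) (g : I ≃ I) : Prop where
  edge_eq : ∀ a, G.edge (g a) = f (G.edge a)
  vert_eq : ∀ a, G.vert (g a) = β.perm (G.vert a)
  sign_eq : ∀ e, G.sign (f e) = (∏ᶠ a ∈ G.ends (f e), β.sgn (G.vert a)) * G.sign e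

variable {G}

theorem Realizes.finite_ends (e : E) : (G.ends e).Finite :=
  Set.finite_of_encard_le_coe (k := 2) (G.encard_ends_le e)

theorem Realizes.prod_ends {β : SignedPerm n} {f : E ≃ E} {g : I ≃ I} (h : G.Realizes β f g)
    (u : I → ℤˣ) (e : E) : ∏ᶠ a ∈ G.ends (f e), u a = ∏ᶠ a ∈ G.ends e, u (g a) := by
  have : G.ends (f e) = g '' G.ends e := by
    ext a
    constructor
    · intro ha
      refine ⟨g.symm a, ?_, by simp⟩
      have h2 := h.edge_eq (g.symm a)
      rw [Equiv.apply_symm_apply] at h2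
      have h3 : G.edge a = f e := ha
      exact f.injective (h2.symm.trans h3)
    · rintro ⟨a, ha, rfl⟩
      have h3 : G.edge a = e := ha
      exact (h.edge_eq a).trans (by rw [h3])
  rw [this, finprod_mem_image g.injective.injOn]

theorem Realizes.one : G.Realizes 1 (Equiv.refl E) (Equiv.refl I) where
  edge_eq _ := rfl
  vert_eq _ := rfl
  sign_eq e := by simp

theorem Realizes.mul {β γ : SignedPerm n} {f f' : E ≃ E} {g g' : I ≃ I}
    (h : G.Realizes β f g) (h' : G.Realizes γ f' g') :
    G.Realizes (β * γ) (f'.trans f) (g'.trans g) where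
  edge_eq a := by simp [h.edge_eq, h'.edge_eq]
  vert_eq a := by simp [h.vert_eq, h'.vert_eq]
  sign_eq e := by
    have h1 := h.prod_ends (fun a => γ.sgn (β.perm.symm (G.vert a))) (f' e)
    simp only [h.vert_eq, Equiv.symm_apply_apply] at h1
    simp only [Equiv.trans_apply, SignedPerm.sgn_mul]
    rw [finprod_mem_mul_distrib (Realizes.finite_ends _), h1, h.sign_eq, h'.sign_eq, mul_assoc]

theorem Realizes.inv {β : SignedPerm n} {f : E ≃ E} {g : I ≃ I} (h : G.Realizes β f g) :
    G.Realizes β⁻¹ f.symm g.symm where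
  edge_eq a := by
    rw [Equiv.eq_symm_apply, ← h.edge_eq, Equiv.apply_symm_apply]
  vert_eq a := by
    rw [SignedPerm.perm_inv, Equiv.Perm.eq_inv_iff_eq, ← h.vert_eq, Equiv.apply_symm_apply]
  sign_eq e := by
    have h1 := h.prod_ends (fun a => β.sgn (G.vert a)) (f.symm e)
    have h2 := h.sign_eq (f.symm e)
    simp only [h.vert_eq] at h1
    simp only [SignedPerm.sgn_inv]
    rw [Equiv.apply_symm_apply] at h1 h2
    rw [← h1, h2, ← mul_assoc, Int.units_mul_self, one_mul]

variable (G)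

/-- The group `B` of automorphisms of a signed graph: the signed permutations that map its edge
multiset (edges with their ends and signs) to itself. -/
def autGroup : Subgroup (SignedPerm n) where
  carrier := {β | ∃ f g, G.Realizes β f g}
  one_mem' := ⟨_, _, Realizes.one⟩
  mul_mem' := fun ⟨_, _, h⟩ ⟨_, _, h'⟩ => ⟨_, _, h.mul h'⟩
  inv_mem' := fun ⟨_, _, h⟩ => ⟨_, _, h.inv⟩

/-- Two acyclic orientations agree up to automorphism if some automorphism `β = (b, δ)` carries the
first to the second; the end of `e` at `i` with sign `τ` is carried to the end of the image of `e`
at `b i` with sign `(-1)^{|δ ∩ {b i}|} τ`. -/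
def orientationSetoid : Setoid G.AcyclicOrientation where
  r o o' := ∃ β f g, G.Realizes β f g ∧
    ∀ a, o'.1.τ (g a) = β.sgn (G.vert (g a)) * o.1.τ a
  iseqv :=
    { refl := fun o => ⟨1, _, _, Realizes.one, fun a => by simp⟩
      symm := by
        rintro o o' ⟨β, f, g, h, ho⟩
        refine ⟨β⁻¹, _, _, h.inv, fun a => ?_⟩
        have h1 := ho (g.symm a)
        have h2 := h.vert_eq (g.symm a)
        rw [Equiv.apply_symm_apply] at h1 h2
        rw [SignedPerm.sgn_inv, ← h2, h1, ← mul_assoc, Int.units_mul_self, one_mul]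
      trans := by
        rintro o o' o'' ⟨β, f, g, h, ho⟩ ⟨γ, f', g', h', ho'⟩
        refine ⟨γ * β, _, _, h'.mul h, fun a => ?_⟩
        rw [Equiv.trans_apply, ho', ho, SignedPerm.sgn_mul, h'.vert_eq, Equiv.symm_apply_apply,
          mul_assoc] }

/-- The set of unlabeled acyclic orientations: acyclic orientations up to automorphism. -/
def UnlabeledAcyclicOrientation : Type _ := Quotient G.orientationSetoid

/-! ### The quotient by a signed permutation -/

open Classical in
/-- The quotient signed graph `Σ/β`. Its vertices are the cycles of `b` that meet `δ` in an even
number of elements. It has the same edges as `Σ`; each end at `i` is moved to the cycle of `i` if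
that cycle is a vertex of `Σ/β`, and is deleted otherwise. An edge that loses an end is negative; an
edge with two ends at `i` and `j`, both of which remain, has the sign `ε(e) (-1)^{β_(i) + β_(j)}`
(for a loop of `Σ`, where `i = j`, this is `ε(e)`); all other edges keep their sign. -/
noncomputable def quotient (β : SignedPerm n) :
    SignedGraph β.EvenCycle E
      {a : I // Even {i | i ∈ β.switch ∧ β.cycleOf i = β.cycleOf (G.vert a)}.ncard} where
  edge a := G.edge a.1
  vert a := ⟨β.cycleOf (G.vert a.1), a.2⟩
  sign e :=
    if ∃ a ∈ G.ends e, ¬ Even {i | i ∈ β.switch ∧ β.cycleOf i = β.cycleOf (G.vert a)}.ncard then -1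
    else if (G.ends e).encard = 2 then
      G.sign e * ∏ᶠ a ∈ G.ends e, (-1 : ℤˣ) ^ β.cycleIndex (G.vert a)
    else G.sign e
  encard_ends_le e := by
    refine le_trans ?_ (G.encard_ends_le e)
    rw [← Function.Injective.encard_image Subtype.val_injective]
    apply Set.encard_le_encard
    rintro _ ⟨a, ha, rfl⟩
    exact ha

end SignedGraph

/-!
An orientation `o` of a signed graph on `[n]` attaches to a potential `x ∈ ℤⁿ` the value
`∑ τ(e,i) x_i` at each edge `e`, and `x` is *positive* for `o` (`Orientation.Compat`) if all values
are positive. For an edge with two ends, at `i` and `j`, the value is `± (x_i - ε(e) x_j)`; so a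
potential is positive for some orientation if and only if it is a proper coloring, and the
orientation is then unique. The orientations with a positive potential are thus the regions of the
arrangement of the hyperplanes `x_i = ε(e) x_j` and `x_i = 0` that belong to the edges.

These orientations are exactly the acyclic ones. On a cycle, the values of a potential, with weight
2 on the connecting path and the half-edges of a handcuff, have sum zero, so they are not all
positive (`Compat.isAcyclic`). Conversely, in an acyclic orientation
every nonempty set of edges has a source or a sink (`IsAcyclic.exists_not_balanced`): otherwise a
directed walk runs into itself and leaves behind a negative circle or a half-edge, and a second walk
which starts there with the opposite sign completes it to a handcuff or closes a positive circle.
Repeated deletion of sources and sinks gives a positive potential (`IsAcyclic.exists_compat`).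

An automorphism carries the positive potentials of an orientation to those of its image. Since an
acyclic orientation is determined by any of its positive potentials, the automorphism group acts on
acyclic orientations, however its elements permute parallel edges, and Burnside's lemma reduces the
theorem to the count of the acyclic orientations fixed by one automorphism `β`. These are the ones
with a positive potential fixed by `β` (`smul_eq_iff`; sum a positive potential over the powers
of `β`), that is, the regions of the arrangement restricted to the fixed space of `β`. The fixed
space is parametrized by the functions on the vertices of the quotient (`SignedPerm.act_eq_iff`),
in such a way that proper colorings of the quotient correspond to fixed proper colorings
(`quotient_isProper_iff`).

What remains is the theorem that the number of points of `[-k, k]^V` off such an arrangement is a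
polynomial in `k` whose value at `-1` is `(-1)^|V|` times the number of regions
(`LitForm.exists_polynomial`). It follows by deletion and restriction from the fact that both counts
satisfy the same recursion up to sign.
-/

/-! ### Arrangements of forms that are sums of two signed coordinates -/

/-- A literal over `V`: a signed coordinate `±y_v`, or `0` (encoded as `none`). -/
abbrev Literal (V : Type*) : Type _ := Option (V × ℤˣ)

namespace Literal

variable {V : Type*}

/-- The value of a literal at a point of `ℤ^V`. -/
def eval (y : V → ℤ) : Literal V → ℤ
  | none => 0
  | some (v, s) => s * y v

/-- A literal multiplied by a sign. -/
def scale (t : ℤˣ) : Literal V → Literal V :=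
  Option.map fun p => (p.1, t * p.2)

theorem eval_scale (t : ℤˣ) (p : Literal V) (y : V → ℤ) :
    (p.scale t).eval y = t * p.eval y := by
  rcases p with _ | ⟨v, s⟩ <;> simp [scale, eval, mul_assoc]

theorem eval_comb (p : Literal V) (a b : ℤ) (y z : V → ℤ) :
    p.eval (fun v => a * y v + b * z v) = a * p.eval y + b * p.eval z := by
  rcases p with _ | ⟨v, s⟩ <;> simp [eval]
  ring

theorem eval_bound (p : Literal V) {k : ℤ} (hk : 0 ≤ k) {y : V → ℤ}
    (hy : ∀ v, -k ≤ y v ∧ y v ≤ k) : -k ≤ p.eval y ∧ p.eval y ≤ k := by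
  rcases p with _ | ⟨v, s⟩
  · simp [eval, hk]
  · have := hy v
    rcases Int.units_eq_one_or s with rfl | rfl <;> simp [eval] <;> omega

/-- The point of `ℤ^V` whose coordinate at `u` is the value of the literal `l` and whose other
coordinates are those of `z`. -/
noncomputable def extend (u : V) (l : Literal {w // w ≠ u}) (z : {w // w ≠ u} → ℤ) (w : V) : ℤ := by
  classical exact if h : w = u then l.eval z else z ⟨w, h⟩

@[simp] theorem extend_self (u : V) (l : Literal {w // w ≠ u}) (z : {w // w ≠ u} → ℤ) :
    extend u l z u = l.eval z := by simp [extend]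

@[simp] theorem extend_coe (u : V) (l : Literal {w // w ≠ u}) (z : {w // w ≠ u} → ℤ)
    (w : {w // w ≠ u}) : extend u l z w = z w := by simp [extend, w.2]

/-- Substitution of the literal `l` for the coordinate `u`. -/
noncomputable def subst (u : V) (l : Literal {w // w ≠ u}) :
    Literal V → Literal {w // w ≠ u}
  | none => none
  | some (w, s) => by classical exact if h : w = u then l.scale s else some (⟨w, h⟩, s)

theorem eval_subst (u : V) (l : Literal {w // w ≠ u}) (p : Literal V) (z : {w // w ≠ u} → ℤ) :
    (Literal.subst u l p).eval z = p.eval (extend u l z) := by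
  rcases p with _ | ⟨w, s⟩
  · rfl
  · by_cases h : w = u
    · subst h
      change (Literal.subst w l (some (w, s))).eval z = s * extend w l z w
      simp [subst, eval_scale]
    · simp [subst, eval, h, extend]

end Literal

/-- A linear form that is the sum of two literals: up to sign, one of `0`, `y_v`, `2 y_v`,
`y_v - y_w` and `y_v + y_w`. -/
abbrev LitForm (V : Type*) : Type _ := Literal V × Literal V

namespace LitForm

variable {V : Type*}

/-- The value of a form at a point of `ℤ^V`. -/
def eval (F : LitForm V) (y : V → ℤ) : ℤ := F.1.eval y + F.2.eval y

theorem eval_comb (F : LitForm V) (a b : ℤ) (y z : V → ℤ) :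
    F.eval (fun v => a * y v + b * z v) = a * F.eval y + b * F.eval z := by
  simp only [eval, Literal.eval_comb]
  ring

/-- The restriction of a form to the hyperplane on which the coordinate `u` equals the
literal `l`. -/
noncomputable def subst (u : V) (l : Literal {w // w ≠ u}) (F : LitForm V) :
    LitForm {w // w ≠ u} := (Literal.subst u l F.1, Literal.subst u l F.2)

theorem eval_subst (u : V) (l : Literal {w // w ≠ u}) (F : LitForm V) (z : {w // w ≠ u} → ℤ) :
    (F.subst u l).eval z = F.eval (Literal.extend u l z) := by
  simp [subst, eval, Literal.eval_subst]

/-- The kernel of a nonzero form is a coordinate hyperplane in disguise: on it, one coordinate is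
a literal in the other coordinates. The class of forms is therefore closed under restriction, and
the kernel meets a cube `[-k, k]^V` in a cube of one dimension less. -/
theorem eq_zero_or_exists_literal (F : LitForm V) : (∀ y, F.eval y = 0) ∨
    ∃ (u : V) (l : Literal {w // w ≠ u}),
      ∀ y, F.eval y = 0 ↔ y u = l.eval fun w : {w // w ≠ u} => y w := by
  have key : ∀ s : ℤˣ, (s : ℤ) = 1 ∨ (s : ℤ) = -1 := fun s => by
    rcases Int.units_eq_one_or s with rfl | rfl <;> simp
  obtain ⟨_ | ⟨v, s⟩, _ | ⟨w, t⟩⟩ := F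
  · exact Or.inl fun y => by simp [eval, Literal.eval]
  · exact Or.inr ⟨w, none, fun y => by simp [eval, Literal.eval]⟩
  · exact Or.inr ⟨v, none, fun y => by simp [eval, Literal.eval]⟩
  · by_cases h : w = v
    · subst h
      by_cases hst : t = -s
      · exact Or.inl fun y => by simp [eval, Literal.eval, hst]
      · refine Or.inr ⟨w, none, fun y => ?_⟩
        have : t = s := by
          rcases Int.units_eq_one_or s with rfl | rfl <;>
          rcases Int.units_eq_one_or t with rfl | rfl <;> simp_all
        subst this
        rcases key t with ht | ht <;> simp only [eval, Literal.eval, ht] <;> omega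
    · refine Or.inr ⟨v, some (⟨w, h⟩, -(s * t)), fun y => ?_⟩
      rcases key s with hs | hs <;> rcases key t with ht | ht <;>
        simp only [eval, Literal.eval, Units.val_neg, Units.val_mul, hs, ht] <;> omega

variable (L : List (LitForm V))

/-- The point `y` lies on none of the hyperplanes. -/
def Generic (y : V → ℤ) : Prop := ∀ F ∈ L, F.eval y ≠ 0

/-- The number of points of the cube `[-k, k]^V` that lie on none of the hyperplanes. -/
noncomputable def numGeneric (k : ℕ) : ℕ :=
  Nat.card {y : V → ℤ // (∀ v, -(k : ℤ) ≤ y v ∧ y v ≤ k) ∧ Generic L y}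

/-- The regions of the arrangement, as the sign vectors of the points off the hyperplanes. -/
def regions : Set (List SignType) :=
  (fun y => L.map fun F => SignType.sign (F.eval y)) '' {y | Generic L y}

variable {L}

theorem finite_regions : (regions L).Finite := by
  refine (List.finite_length_eq SignType L.length).subset ?_
  rintro _ ⟨y, -, rfl⟩
  simp

theorem finite_box [Finite V] (k : ℕ) (p : (V → ℤ) → Prop) :
    Finite {y : V → ℤ // (∀ v, -(k : ℤ) ≤ y v ∧ y v ≤ k) ∧ p y} := by
  have : ({y : V → ℤ | ∀ v, -(k : ℤ) ≤ y v ∧ y v ≤ k} : Set (V → ℤ)).Finite := by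
    refine (Set.Finite.pi' (t := fun _ : V => Set.Icc (-(k : ℤ)) k) fun _ =>
      Set.finite_Icc _ _).subset fun y hy v => hy v
  exact (this.subset fun y (hy : _ ∧ p y) => hy.1).to_subtype

/-- Deletion and restriction for the points of a cube. -/
theorem numGeneric_cons [Finite V] {F : LitForm V} {u : V} {l : Literal {w // w ≠ u}}
    (h : ∀ y, F.eval y = 0 ↔ y u = l.eval fun w : {w // w ≠ u} => y w) (k : ℕ) :
    numGeneric (F :: L) k + numGeneric (L.map (subst u l)) k = numGeneric L k := by
  have e1 : numGeneric (L.map (subst u l)) k = Nat.card {y : V → ℤ //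
      (∀ v, -(k : ℤ) ≤ y v ∧ y v ≤ k) ∧ (Generic L y ∧ F.eval y = 0)} := by
    refine Nat.card_congr ⟨fun z => ⟨Literal.extend u l z.1, fun v => ?_, fun G hG => ?_, ?_⟩,
      fun y => ⟨fun w => y.1 w, fun w => y.2.1 w, fun G hG => ?_⟩, fun z => ?_, fun y => ?_⟩
    · by_cases hv : v = u
      · subst hv
        rw [Literal.extend_self]
        exact l.eval_bound (by positivity) z.2.1
      · exact Literal.extend_coe u l z.1 ⟨v, hv⟩ ▸ z.2.1 ⟨v, hv⟩
    · rw [← eval_subst]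
      exact z.2.2 _ (List.mem_map_of_mem hG)
    · rw [h]
      simp
    · obtain ⟨G', hG', rfl⟩ := List.mem_map.1 hG
      have : Literal.extend u l (fun w => y.1 w) = y.1 := by
        funext v
        by_cases hv : v = u
        · subst hv
          rw [Literal.extend_self, ← (h y.1).1 y.2.2.2]
        · exact Literal.extend_coe u l _ ⟨v, hv⟩
      rw [eval_subst, this]
      exact y.2.2.1 _ hG'
    · ext w
      simp
    · ext v
      by_cases hv : v = u
      · subst hv
        simp only [Literal.extend_self]
        exact ((h y.1).1 y.2.2.2).symm
      · exact Literal.extend_coe u l _ ⟨v, hv⟩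
  have e2 : numGeneric (F :: L) k = Nat.card {y : V → ℤ //
      (∀ v, -(k : ℤ) ≤ y v ∧ y v ≤ k) ∧ (Generic L y ∧ F.eval y ≠ 0)} := by
    refine Nat.card_congr (Equiv.subtypeEquivRight fun y => ?_)
    simp only [Generic, List.forall_mem_cons]
    tauto
  rw [e1, e2, numGeneric]
  have := finite_box (V := V) k fun y => Generic L y ∧ F.eval y ≠ 0
  have := finite_box (V := V) k fun y => Generic L y ∧ F.eval y = 0
  have := finite_box (V := V) k fun y => Generic L y
  rw [← Nat.card_sum]
  classical
  refine Nat.card_congr ⟨Sum.elim (fun y => ⟨y.1, y.2.1, y.2.2.1⟩) (fun y => ⟨y.1, y.2.1, y.2.2.1⟩),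
    fun y => if hy : F.eval y.1 = 0 then Sum.inr ⟨y.1, y.2.1, y.2.2, hy⟩ else
      Sum.inl ⟨y.1, y.2.1, y.2.2, hy⟩, ?_, ?_⟩
  · rintro (y | y)
    · simp [y.2.2.2]
    · simp [y.2.2.2]
  · intro y
    dsimp only
    split_ifs <;> rfl

theorem sign_pos_mul_add {a b : ℤ} (ha : a ≠ 0) {K : ℤ} (hK : |b| < K) :
    SignType.sign (K * a + b) = SignType.sign a := by
  have h1 := abs_lt.1 hK
  rcases lt_or_gt_of_ne ha with h | h
  · rw [sign_neg h, sign_neg]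
    nlinarith
  · rw [sign_pos h, sign_pos]
    nlinarith

/-- Deletion and restriction for regions: a hyperplane cuts in two exactly the regions that it
meets, and these correspond to the regions of the restriction. -/
theorem ncard_regions_cons {F : LitForm V} {u : V} {l : Literal {w // w ≠ u}}
    (h : ∀ y, F.eval y = 0 ↔ y u = l.eval fun w : {w // w ≠ u} => y w) :
    (regions (F :: L)).ncard = (regions L).ncard + (regions (L.map (subst u l))).ncard := by
  classical
  -- the sign vectors of the regions of `L` that have a point on the side `s` of the new hyperplane
  let side : SignType → Set (List SignType) := fun s =>
    (fun y => L.map fun F => SignType.sign (F.eval y)) ''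
      {y | Generic L y ∧ SignType.sign (F.eval y) = s}
  have hside : ∀ s, (side s).Finite := fun s =>
    finite_regions.subset (Set.image_mono fun y hy => hy.1)
  have hcons : regions (F :: L) = List.cons 1 '' side 1 ∪ List.cons (-1) '' side (-1) := by
    ext σ
    constructor
    · rintro ⟨y, hy, rfl⟩
      have h0 := hy F (by simp)
      have hL : Generic L y := fun G hG => hy G (by simp [hG])
      rcases lt_or_gt_of_ne h0 with h1 | h1
      · exact Or.inr ⟨_, ⟨y, ⟨hL, sign_neg h1⟩, rfl⟩, by simp [sign_neg h1]⟩
      · exact Or.inl ⟨_, ⟨y, ⟨hL, sign_pos h1⟩, rfl⟩, by simp [sign_pos h1]⟩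
    · rintro (⟨_, ⟨y, ⟨hL, hs⟩, rfl⟩, rfl⟩ | ⟨_, ⟨y, ⟨hL, hs⟩, rfl⟩, rfl⟩) <;>
      · refine ⟨y, ?_, by simp [hs]⟩
        intro G hG
        rcases List.mem_cons.1 hG with rfl | hG
        · intro h0
          simp [h0] at hs
        · exact hL G hG
  -- a point on the new hyperplane can be moved off it to either side
  have move : ∀ y, Generic L y → F.eval y = 0 → ∀ s : ℤˣ,
      ∃ z, Generic L z ∧ SignType.sign (F.eval z) = SignType.sign (s : ℤ) ∧
        (L.map fun F => SignType.sign (F.eval z)) = L.map fun F => SignType.sign (F.eval y) := by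
    intro y hy h0 s
    obtain ⟨v, hv⟩ : ∃ v, 0 < F.eval v := by
      have h1 : F.eval (Function.update y u (y u + 1)) ≠ 0 := by
        rw [Ne, h]
        have h2 : (fun w : {w // w ≠ u} => Function.update y u (y u + 1) w) =
            fun w : {w // w ≠ u} => y w := by
          funext w
          simp [w.2]
        rw [h2, ← (h y).1 h0]
        simp
      rcases lt_or_gt_of_ne h1 with h1 | h1
      · refine ⟨fun w => (-1) * Function.update y u (y u + 1) w + 0 * y w, ?_⟩
        rw [eval_comb]
        linarith
      · exact ⟨_, h1⟩
    obtain ⟨K, hK⟩ : ∃ K : ℤ, ∀ G ∈ L, |(s : ℤ) * G.eval v| < K := by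
      refine ⟨(L.map fun G => |(s : ℤ) * G.eval v|).sum + 1, fun G hG => Int.lt_add_one_iff.2 ?_⟩
      refine List.single_le_sum ?_ _
        (List.mem_map_of_mem (f := fun G : LitForm V => |(s : ℤ) * G.eval v|) hG)
      intro x hx
      obtain ⟨G', -, rfl⟩ := List.mem_map.1 hx
      positivity
    have hz : ∀ G ∈ L, SignType.sign (G.eval fun w => K * y w + (s : ℤ) * v w) =
        SignType.sign (G.eval y) := fun G hG => by
      rw [eval_comb]
      exact sign_pos_mul_add (hy G hG) (hK G hG)
    refine ⟨fun w => K * y w + (s : ℤ) * v w, fun G hG h1 => ?_, ?_, List.map_congr_left hz⟩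
    · have h2 := hz G hG
      rw [h1, sign_zero] at h2
      exact hy G hG (sign_eq_zero_iff.1 h2.symm)
    · rw [eval_comb, h0, mul_zero, zero_add, sign_mul, sign_pos hv, mul_one]
  have hunion : side 1 ∪ side (-1) = regions L := by
    apply Set.Subset.antisymm
    · exact Set.union_subset (Set.image_mono fun y hy => hy.1) (Set.image_mono fun y hy => hy.1)
    · rintro _ ⟨y, hy, rfl⟩
      rcases lt_trichotomy (F.eval y) 0 with h0 | h0 | h0
      · exact Or.inr ⟨y, ⟨hy, sign_neg h0⟩, rfl⟩
      · obtain ⟨z, hz, hs, he⟩ := move y hy h0 1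
        exact Or.inl ⟨z, ⟨hz, by simpa using hs⟩, he⟩
      · exact Or.inl ⟨y, ⟨hy, sign_pos h0⟩, rfl⟩
  have hinter : side 1 ∩ side (-1) = regions (L.map (subst u l)) := by
    apply Set.Subset.antisymm
    · rintro _ ⟨⟨y, ⟨hy, hsy⟩, rfl⟩, ⟨z, ⟨hz, hsz⟩, hyz⟩⟩
      have hsy := sign_eq_one_iff.1 hsy
      have hsz := sign_eq_neg_one_iff.1 hsz
      -- the point of the segment from `y` to `z` on the hyperplane
      let x : V → ℤ := fun w => (-F.eval z) * y w + F.eval y * z w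
      have hx : F.eval x = 0 := by
        rw [eval_comb]
        ring
      have hG : ∀ G ∈ L, SignType.sign (G.eval x) = SignType.sign (G.eval y) := by
        intro G hG
        have h1 : SignType.sign (G.eval z) = SignType.sign (G.eval y) :=
          (List.map_inj_left.1 hyz) G hG
        rw [eval_comb]
        rcases lt_or_gt_of_ne (hy G hG) with h2 | h2
        · rw [sign_neg h2] at h1 ⊢
          rw [sign_eq_neg_one_iff] at h1 ⊢
          nlinarith
        · rw [sign_pos h2] at h1 ⊢
          rw [sign_eq_one_iff] at h1 ⊢
          nlinarith
      have hext : Literal.extend u l (fun w => x w) = x := by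
        funext v
        by_cases hv : v = u
        · subst hv
          rw [Literal.extend_self, ← (h x).1 hx]
        · exact Literal.extend_coe u l _ ⟨v, hv⟩
      refine ⟨fun w => x w, ?_, ?_⟩
      · intro G' hG'
        obtain ⟨G, hGL, rfl⟩ := List.mem_map.1 hG'
        rw [eval_subst, hext]
        intro h0
        have h1 := hG G hGL
        rw [h0, sign_zero] at h1
        exact hy G hGL (sign_eq_zero_iff.1 h1.symm)
      · simp only [List.map_map]
        refine List.map_congr_left fun G hGL => ?_
        simp only [Function.comp_apply, eval_subst, hext]
        exact hG G hGL
    · rintro _ ⟨z, hz, rfl⟩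
      have hy : Generic L (Literal.extend u l z) := fun G hG => by
        rw [← eval_subst]
        exact hz _ (List.mem_map_of_mem hG)
      have h0 : F.eval (Literal.extend u l z) = 0 := by
        rw [h]
        simp
      have he : ((L.map (subst u l)).map fun F => SignType.sign (F.eval z)) =
          L.map fun F => SignType.sign (F.eval (Literal.extend u l z)) := by
        simp only [List.map_map]
        refine List.map_congr_left fun G hGL => ?_
        simp only [Function.comp_apply, eval_subst]
      obtain ⟨z1, hz1, hs1, he1⟩ := move _ hy h0 1
      obtain ⟨z2, hz2, hs2, he2⟩ := move _ hy h0 (-1)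
      dsimp only
      rw [he]
      exact ⟨⟨z1, ⟨hz1, by simpa using hs1⟩, he1⟩, ⟨z2, ⟨hz2, by simpa using hs2⟩, he2⟩⟩
  rw [hcons, Set.ncard_union_eq ?_ ((hside _).image _) ((hside _).image _),
    Set.ncard_image_of_injective _ List.cons_injective,
    Set.ncard_image_of_injective _ List.cons_injective,
    ← Set.ncard_union_add_ncard_inter _ _ (hside _) (hside _), hunion, hinter]
  rw [Set.disjoint_left]
  rintro _ ⟨σ, -, rfl⟩ ⟨σ', -, h1⟩
  exact absurd (List.cons.inj h1).1 (by decide)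

/-- The points of cubes off an arrangement are counted by a polynomial, whose value at `-1` is, up
to sign, the number of regions. -/
theorem exists_polynomial (m : ℕ) : ∀ (V : Type) [Finite V] (L : List (LitForm V)), L.length = m →
    ∃ P : ℚ[X], (∀ k : ℕ, P.eval (k : ℚ) = numGeneric L k) ∧
      P.eval (-1) = (-1) ^ Nat.card V * (regions L).ncard := by
  induction m with
  | zero =>
    intro V _ L hL
    have := Fintype.ofFinite V
    classical
    obtain rfl := List.length_eq_zero_iff.1 hL
    refine ⟨(2 * X + 1) ^ Nat.card V, fun k => ?_, ?_⟩
    · have e : {y : V → ℤ // (∀ v, -(k : ℤ) ≤ y v ∧ y v ≤ k) ∧ Generic [] y} ≃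
          (V → Set.Icc (-(k : ℤ)) k) :=
        ⟨fun y v => ⟨y.1 v, y.2.1 v⟩, fun y => ⟨fun v => y v, fun v => (y v).2, by simp [Generic]⟩,
          fun y => rfl, fun y => rfl⟩
      rw [numGeneric, Nat.card_congr e, Nat.card_fun]
      simp
      congr 1
      have h1 : ((k : ℤ) + 1 + k).toNat = 2 * k + 1 := by omega
      rw [h1]
      push_cast
      rfl
    · have : regions ([] : List (LitForm V)) = {[]} := by
        simp [regions, Generic]
      rw [this]
      simp
      norm_num
  | succ m ih =>
    intro V _ L hL
    classical
    obtain ⟨F, L, rfl⟩ := List.exists_cons_of_length_eq_add_one hL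
    simp only [List.length_cons, Nat.add_right_cancel_iff] at hL
    rcases F.eq_zero_or_exists_literal with h | ⟨u, l, h⟩
    · have hF : ∀ y, ¬ Generic (F :: L) y := fun y hy => hy F (by simp) (h y)
      refine ⟨0, fun k => ?_, ?_⟩
      · have : IsEmpty {y : V → ℤ // (∀ v, -(k : ℤ) ≤ y v ∧ y v ≤ k) ∧ Generic (F :: L) y} :=
          ⟨fun y => hF _ y.2.2⟩
        rw [numGeneric, Nat.card_of_isEmpty]
        simp
      · simp [regions, hF]
    · obtain ⟨P, hP, hP1⟩ := ih V L hL
      obtain ⟨Q, hQ, hQ1⟩ := ih _ (L.map (subst u l)) (by simpa using hL)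
      refine ⟨P - Q, fun k => ?_, ?_⟩
      · rw [eval_sub, hP, hQ, ← numGeneric_cons h k]
        simp
      · have hV : Nat.card V = Nat.card {w // w ≠ u} + 1 := by
          have := Fintype.ofFinite V
          simp only [Nat.card_eq_fintype_card, ne_eq, Fintype.card_subtype_compl,
            Fintype.card_subtype_eq]
          have := Fintype.card_pos_iff.2 ⟨u⟩
          omega
        rw [eval_sub, hP1, hQ1, ncard_regions_cons h, hV]
        push_cast
        ring

end LitForm

/-! ### Orientations and potentials -/

namespace SignedGraph

variable {V E I : Type*} {G : SignedGraph V E I}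

theorem ends_cases (G : SignedGraph V E I) (e : E) : G.ends e = ∅ ∨ (∃ a, G.ends e = {a}) ∨
    ∃ a b, a ≠ b ∧ G.ends e = {a, b} := by
  by_contra! h
  obtain ⟨a, ha⟩ := h.1
  obtain ⟨b, hb, hba⟩ : ∃ b ∈ G.ends e, b ≠ a := by
    by_contra! h'
    exact h.2.1 a (Set.eq_singleton_iff_unique_mem.2 ⟨ha, h'⟩)
  have hsub : ({a, b} : Set I) ⊆ G.ends e := Set.insert_subset ha (Set.singleton_subset_iff.2 hb)
  have hfin : ({a, b} : Set I).Finite := by simp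
  refine h.2.2 a b hba.symm (hfin.eq_of_subset_of_encard_le hsub ?_).symm
  rw [Set.encard_pair hba.symm]
  exact G.encard_ends_le e

theorem edge_eq_of_ends_eq_pair {e : E} {a b : I} (h : G.ends e = {a, b}) :
    G.edge a = e ∧ G.edge b = e :=
  ⟨(h ▸ Set.mem_insert a {b} : a ∈ G.ends e), (h ▸ Set.mem_insert_of_mem a rfl : b ∈ G.ends e)⟩

theorem edge_eq_of_ends_eq_singleton {e : E} {a : I} (h : G.ends e = {a}) : G.edge a = e :=
  (h ▸ Set.mem_singleton a : a ∈ G.ends e)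

theorem ends_eq_pair {a b : I} (hab : a ≠ b) (h : G.edge a = G.edge b) :
    G.ends (G.edge a) = {a, b} := by
  have ha : a ∈ G.ends (G.edge a) := rfl
  have hb : b ∈ G.ends (G.edge a) := h.symm
  rcases G.ends_cases (G.edge a) with h0 | ⟨c, h0⟩ | ⟨c, d, -, h0⟩
  · simp [h0] at ha
  · rw [h0] at ha hb
    exact absurd (ha.trans hb.symm) hab
  · rw [h0] at ha hb ⊢
    rcases ha with rfl | ha <;> rcases hb with rfl | hb
    · exact absurd rfl hab
    · rw [hb]
    · rw [ha, Set.pair_comm]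
    · exact absurd (Eq.trans ha (Eq.symm hb)) hab

theorem mem_verts {C : Set E} {a : I} (h : G.edge a ∈ C) : G.vert a ∈ G.verts C := ⟨a, h, rfl⟩

theorem verts_union (C D : Set E) : G.verts (C ∪ D) = G.verts C ∪ G.verts D := by
  ext v
  constructor
  · rintro ⟨a, ha | ha, rfl⟩
    · exact Or.inl (mem_verts ha)
    · exact Or.inr (mem_verts ha)
  · rintro (⟨a, ha, rfl⟩ | ⟨a, ha, rfl⟩)
    · exact mem_verts (Or.inl ha)
    · exact mem_verts (Or.inr ha)

theorem verts_mono {C D : Set E} (h : C ⊆ D) : G.verts C ⊆ G.verts D := by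
  rintro _ ⟨a, ha, rfl⟩
  exact mem_verts (h ha)

namespace Orientation

/-- The value at the edge `e` of the coboundary of a potential `x`: the sum of `τ(e,i) x_i` over
the ends of `e`. For an edge with two ends, at `i` and `j`, it is `± (x_i - ε(e) x_j)`. -/
noncomputable def value (o : G.Orientation) (x : V → ℤ) (e : E) : ℤ :=
  ∑ᶠ a ∈ G.ends e, (o.τ a : ℤ) * x (G.vert a)

/-- The potential `x` lies in the open cone of the orientation `o`. -/
def Compat (o : G.Orientation) (x : V → ℤ) : Prop := ∀ e, 0 < o.value x e

/-- There are ends of both signs at `v` among the ends of the edges of `C`: the vertex is neither a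
source nor a sink of `C`. -/
def Balanced (o : G.Orientation) (C : Set E) (v : V) : Prop :=
  (∃ a, G.edge a ∈ C ∧ G.vert a = v ∧ o.τ a = 1) ∧
    (∃ a, G.edge a ∈ C ∧ G.vert a = v ∧ o.τ a = -1)

/-- The divergence at `v` of the set `C` of oriented edges. -/
noncomputable def div (o : G.Orientation) (C : Set E) (v : V) : ℤ :=
  ∑ᶠ a ∈ {a | G.edge a ∈ C ∧ G.vert a = v}, (o.τ a : ℤ)

variable {o : G.Orientation} {x : V → ℤ} {C : Set E}

theorem value_of_ends_eq_empty {e : E} (h : G.ends e = ∅) : o.value x e = 0 := by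
  simp [value, h]

theorem value_of_ends_eq_singleton {e : E} {a : I} (h : G.ends e = {a}) :
    o.value x e = o.τ a * x (G.vert a) := by
  rw [value, h, finsum_mem_singleton]

theorem value_of_ends_eq_pair {e : E} {a b : I} (hab : a ≠ b) (h : G.ends e = {a, b}) :
    o.value x e = o.τ a * x (G.vert a) + o.τ b * x (G.vert b) := by
  rw [value, h, finsum_mem_pair hab]

theorem τ_eq_of_ends_eq_pair {e : E} {a b : I} (hab : a ≠ b) (h : G.ends e = {a, b}) :
    o.τ b = -G.sign e * o.τ a := by
  obtain ⟨h1, h2⟩ := edge_eq_of_ends_eq_pair h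
  have := o.compat b a hab.symm (h2.trans h1.symm)
  rwa [h2] at this

/-- Summation of the values of a positive potential over a set of edges, arranged by vertices. -/
theorem Compat.sum_div_pos [Finite V] [Finite E] [Finite I] (hx : o.Compat x)
    (hC : C.Nonempty) : 0 < ∑ᶠ v, o.div C v * x v := by
  classical
  have := Fintype.ofFinite V
  have := Fintype.ofFinite E
  have := Fintype.ofFinite I
  have h1 : 0 < ∑ e ∈ C.toFinset, o.value x e :=
    Finset.sum_pos (fun e _ => hx e) (Set.toFinset_nonempty.2 hC)
  have h2 : ∑ e ∈ C.toFinset, o.value x e =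
      ∑ a with G.edge a ∈ C, (o.τ a : ℤ) * x (G.vert a) := by
    rw [← Finset.sum_fiberwise_of_maps_to (g := G.edge) (t := C.toFinset) (by simp)]
    refine Finset.sum_congr rfl fun e he => ?_
    rw [value, finsum_mem_eq_toFinset_sum]
    refine Finset.sum_congr ?_ fun _ _ => rfl
    ext a
    simp only [Finset.mem_filter, Finset.mem_univ, true_and]
    rw [Set.mem_toFinset] at he ⊢
    exact ⟨fun h => ⟨h ▸ he, h⟩, fun h => h.2⟩
  have h3 : ∑ᶠ v, o.div C v * x v = ∑ a with G.edge a ∈ C, (o.τ a : ℤ) * x (G.vert a) := by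
    rw [finsum_eq_sum_of_fintype,
      ← Finset.sum_fiberwise_of_maps_to (g := G.vert) (t := Finset.univ) (by simp)]
    refine Finset.sum_congr rfl fun v _ => ?_
    rw [div, finsum_mem_eq_toFinset_sum, Finset.sum_mul]
    refine Finset.sum_congr ?_ fun a ha => ?_
    · ext a
      simp
    · have : G.vert a = v := by simp at ha; exact ha.2
      rw [this]
  rw [h3, ← h2]
  exact h1

/-- At a vertex at which a set of edges has two ends, these have opposite signs or equal signs. -/
theorem balanced_or_of_degIn_eq_two (o : G.Orientation) {v : V} (h : G.degIn C v = 2) :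
    (o.Balanced C v ∧ o.div C v = 0 ∧ ∏ᶠ a ∈ {a | G.edge a ∈ C ∧ G.vert a = v}, o.τ a = -1) ∨
    (¬ o.Balanced C v ∧ ∏ᶠ a ∈ {a | G.edge a ∈ C ∧ G.vert a = v}, o.τ a = 1 ∧
      ∃ s : ℤˣ, o.div C v = 2 * s ∧ ∀ a, G.edge a ∈ C → G.vert a = v → o.τ a = s) := by
  obtain ⟨a, b, hab, he⟩ := Set.ncard_eq_two.1 h
  have hiff : ∀ c, G.edge c ∈ C ∧ G.vert c = v ↔ c = a ∨ c = b := fun c =>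
    Set.ext_iff.1 he c
  have ha := (hiff a).2 (Or.inl rfl)
  have hb := (hiff b).2 (Or.inr rfl)
  rw [div, he, finsum_mem_pair hab, finprod_mem_pair hab]
  by_cases hs : o.τ a = o.τ b
  · refine Or.inr ⟨?_, by rw [hs, Int.units_mul_self], o.τ b, by rw [hs]; ring, fun c h1 h2 => ?_⟩
    · rintro ⟨⟨c, hc1, hc2, hc⟩, d, hd1, hd2, hd⟩
      have hcb : o.τ c = o.τ b := by
        rcases (hiff c).1 ⟨hc1, hc2⟩ with rfl | rfl
        · exact hs
        · rfl
      have hdb : o.τ d = o.τ b := by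
        rcases (hiff d).1 ⟨hd1, hd2⟩ with rfl | rfl
        · exact hs
        · rfl
      rw [hc] at hcb
      rw [hd, ← hcb] at hdb
      exact absurd hdb (by decide)
    · rcases (hiff c).1 ⟨h1, h2⟩ with rfl | rfl
      · exact hs
      · rfl
  · refine Or.inl ?_
    rcases Int.units_eq_one_or (o.τ a) with h1 | h1 <;>
      rcases Int.units_eq_one_or (o.τ b) with h2 | h2
    · exact absurd (h1.trans h2.symm) hs
    · exact ⟨⟨⟨a, ha.1, ha.2, h1⟩, b, hb.1, hb.2, h2⟩, by simp [h1, h2], by simp [h1, h2]⟩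
    · exact ⟨⟨⟨b, hb.1, hb.2, h2⟩, a, ha.1, ha.2, h1⟩, by simp [h1, h2], by simp [h1, h2]⟩
    · exact absurd (h1.trans h2.symm) hs

end Orientation

/-- For any orientation, the sign of a circle is the product over its vertices of the negated
product of the signs of the two ends at the vertex: it is `-1` to the number of sources and
sinks of the circle. -/
theorem IsCircle.signProd_eq [Finite E] [Finite I] {C : Set E} (hC : G.IsCircle C)
    (o : G.Orientation) : G.signProd C =
      ∏ᶠ v ∈ G.verts C, -∏ᶠ a ∈ {a | G.edge a ∈ C ∧ G.vert a = v}, o.τ a := by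
  classical
  have := Fintype.ofFinite E
  have := Fintype.ofFinite I
  have hfin : (G.verts C).Finite := (Set.finite_range G.vert).subset (by
    rintro _ ⟨a, -, rfl⟩
    exact ⟨a, rfl⟩)
  have := hfin.fintype
  obtain ⟨-, -, hends, hdeg⟩ := hC
  have hpair : ∀ e ∈ C, ∃ a b, a ≠ b ∧ G.ends e = {a, b} := fun e he =>
    Set.encard_eq_two.1 (hends e he)
  have hcardE : ∀ e ∈ C.toFinset,
      ({a ∈ ({a | G.edge a ∈ C} : Finset I) | G.edge a = e} : Finset I).card = 2 := by
    intro e he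
    have he' := Set.mem_toFinset.1 he
    obtain ⟨a, b, hab, h⟩ := hpair e he'
    rw [← Finset.card_pair hab]
    congr 1
    ext c
    have h1 := Set.ext_iff.1 h c
    simp only [ends, Set.mem_ofPred_eq, Set.mem_insert_iff, Set.mem_singleton_iff] at h1
    simp only [Finset.mem_filter, Finset.mem_univ, true_and, Finset.mem_insert,
      Finset.mem_singleton, ← h1]
    exact ⟨fun h => h.2, fun h => ⟨h ▸ he', h⟩⟩
  have hcardV : ∀ v ∈ (G.verts C).toFinset,
      ({a ∈ ({a | G.edge a ∈ C} : Finset I) | G.vert a = v} : Finset I).card = 2 := by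
    intro v hv
    rw [← hdeg v (Set.mem_toFinset.1 hv), degIn, Set.ncard_eq_toFinset_card']
    congr 1
    ext c
    simp
  have hmapE : ∀ a ∈ ({a | G.edge a ∈ C} : Finset I), G.edge a ∈ C.toFinset := by simp
  have hmapV : ∀ a ∈ ({a | G.edge a ∈ C} : Finset I), G.vert a ∈ (G.verts C).toFinset := by
    intro a ha
    simp only [Finset.mem_filter, Finset.mem_univ, true_and] at ha
    exact Set.mem_toFinset.2 (mem_verts ha)
  have hcard : C.toFinset.card = (G.verts C).toFinset.card := by
    have h1 := Finset.card_eq_sum_card_fiberwise hmapE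
    have h2 := Finset.card_eq_sum_card_fiberwise hmapV
    rw [Finset.sum_congr rfl hcardE, Finset.sum_const] at h1
    rw [Finset.sum_congr rfl hcardV, Finset.sum_const] at h2
    simp only [smul_eq_mul] at h1 h2
    omega
  have hE : ∏ a with G.edge a ∈ C, o.τ a = ∏ e ∈ C.toFinset, -G.sign e := by
    rw [← Finset.prod_fiberwise_of_maps_to hmapE]
    refine Finset.prod_congr rfl fun e he => ?_
    have he' := Set.mem_toFinset.1 he
    obtain ⟨a, b, hab, h⟩ := hpair e he'
    have hfil : ({a ∈ ({a | G.edge a ∈ C} : Finset I) | G.edge a = e} : Finset I) = {a, b} := by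
      ext c
      have h1 := Set.ext_iff.1 h c
      simp only [ends, Set.mem_ofPred_eq, Set.mem_insert_iff, Set.mem_singleton_iff] at h1
      simp only [Finset.mem_filter, Finset.mem_univ, true_and, Finset.mem_insert,
        Finset.mem_singleton, ← h1]
      exact ⟨fun h => h.2, fun h => ⟨h ▸ he', h⟩⟩
    rw [hfil, Finset.prod_pair hab, o.τ_eq_of_ends_eq_pair hab h, mul_left_comm,
      Int.units_mul_self, mul_one]
  have hV : ∏ a with G.edge a ∈ C, o.τ a = ∏ v ∈ (G.verts C).toFinset,
      ∏ᶠ a ∈ {a | G.edge a ∈ C ∧ G.vert a = v}, o.τ a := by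
    rw [← Finset.prod_fiberwise_of_maps_to hmapV]
    refine Finset.prod_congr rfl fun v hv => ?_
    rw [finprod_mem_eq_toFinset_prod]
    refine Finset.prod_congr ?_ fun _ _ => rfl
    ext c
    simp
  rw [signProd, finprod_mem_eq_toFinset_prod, finprod_mem_eq_toFinset_prod, Finset.prod_neg,
    ← hV, hE, Finset.prod_neg, hcard, ← mul_assoc, Int.units_mul_self, one_mul]

theorem IsCircle.signProd_eq_one [Finite E] [Finite I] {C : Set E} (hC : G.IsCircle C)
    {o : G.Orientation} (h : ∀ v ∈ G.verts C, o.Balanced C v) : G.signProd C = 1 := by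
  rw [hC.signProd_eq o]
  refine finprod_mem_eq_one_of_forall_eq_one fun v hv => ?_
  rcases o.balanced_or_of_degIn_eq_two (hC.2.2.2 v hv) with h1 | h1
  · rw [h1.2.2, neg_neg]
  · exact absurd (h v hv) h1.1

theorem IsCircle.signProd_eq_neg_one [Finite E] [Finite I] {C : Set E} (hC : G.IsCircle C)
    {o : G.Orientation} {u : V} (hu : u ∈ G.verts C) (hub : ¬ o.Balanced C u)
    (h : ∀ v ∈ G.verts C, v ≠ u → o.Balanced C v) : G.signProd C = -1 := by
  have hfin : (G.verts C).Finite := (Set.finite_range G.vert).subset (by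
    rintro _ ⟨a, -, rfl⟩
    exact ⟨a, rfl⟩)
  rw [hC.signProd_eq o, ← Set.insert_sdiff_self_of_mem hu,
    finprod_mem_insert _ (by simp) (hfin.subset Set.sdiff_subset)]
  rw [finprod_mem_eq_one_of_forall_eq_one (s := G.verts C \ {u}) fun v hv => ?_]
  · rcases o.balanced_or_of_degIn_eq_two (hC.2.2.2 u hu) with h1 | h1
    · exact absurd h1.1 hub
    · rw [h1.2.1, mul_one]
  · rcases o.balanced_or_of_degIn_eq_two (hC.2.2.2 v hv.1) with h1 | h1
    · rw [h1.2.2, neg_neg]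
    · exact absurd (h v hv.1 hv.2) h1.1

namespace Orientation

variable {o : G.Orientation} {x : V → ℤ} {C : Set E}

theorem div_of_notMem_verts {v : V} (h : v ∉ G.verts C) : o.div C v = 0 := by
  have : {a | G.edge a ∈ C ∧ G.vert a = v} = ∅ := by
    ext a
    simp only [Set.mem_ofPred_eq, Set.mem_empty_iff_false, iff_false]
    rintro ⟨h1, rfl⟩
    exact h (mem_verts h1)
  rw [div, this, finsum_mem_empty]

/-- If all vertices of an unbalanced figure but one are neither sources nor sinks of it, then that
vertex is a source or a sink, and a positive potential has the matching sign there. -/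
theorem Compat.pos_of_isUnbalancedFigure [Finite V] [Finite E] [Finite I] (hx : o.Compat x)
    (hC : G.IsUnbalancedFigure C) {u : V} (hu : u ∈ G.verts C)
    (h : ∀ v ∈ G.verts C, v ≠ u → o.Balanced C v) :
    ∃ s : ℤˣ, (∀ a, G.edge a ∈ C → G.vert a = u → o.τ a = s) ∧ 0 < s * x u := by
  rcases hC with ⟨hC, hsign⟩ | ⟨e, rfl, he⟩
  · have hub : ¬ o.Balanced C u := fun hub => by
      have h1 := hC.signProd_eq_one (o := o) fun v hv => by
        by_cases hvu : v = u
        · rwa [hvu]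
        · exact h v hv hvu
      rw [hsign] at h1
      exact absurd h1 (by decide)
    rcases o.balanced_or_of_degIn_eq_two (hC.2.2.2 u hu) with h1 | ⟨-, -, s, hs, hs'⟩
    · exact absurd h1.1 hub
    · refine ⟨s, hs', ?_⟩
      have h2 := hx.sum_div_pos hC.1
      rw [finsum_eq_single _ u, hs] at h2
      · linarith
      · intro v hv
        by_cases hvC : v ∈ G.verts C
        · rcases o.balanced_or_of_degIn_eq_two (hC.2.2.2 v hvC) with h1 | h1
          · rw [h1.2.1, zero_mul]
          · exact absurd (h v hvC hv) h1.1
        · rw [div_of_notMem_verts hvC, zero_mul]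
  · obtain ⟨a, ha⟩ := Set.encard_eq_one.1 he
    have h1 : ∀ b, G.edge b = e → b = a := fun b hb => (Set.ext_iff.1 ha b).1 hb
    obtain ⟨b, hb, rfl⟩ := hu
    obtain rfl := h1 b hb
    refine ⟨o.τ b, fun c hc _ => by rw [h1 c hc], ?_⟩
    rw [← value_of_ends_eq_singleton ha]
    exact hx e

/-- A positive potential on a path whose inner vertices are neither sources nor sinks. -/
theorem Compat.pos_of_isPath [Finite V] [Finite E] [Finite I] (hx : o.Compat x) {P : Set E}
    {u w : V} (hP : G.IsPath P u w)
    (h : ∀ v ∈ G.verts P, v ≠ u → v ≠ w → o.Balanced P v) :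
    ∃ s t : ℤˣ, (∃ a, G.edge a ∈ P ∧ G.vert a = u) ∧
      (∀ a, G.edge a ∈ P → G.vert a = u → o.τ a = s) ∧
      (∀ a, G.edge a ∈ P → G.vert a = w → o.τ a = t) ∧ 0 < s * x u + t * x w := by
  obtain ⟨huw, -, -, hu, hw, hin⟩ := hP
  obtain ⟨a, ha⟩ := Set.ncard_eq_one.1 hu
  obtain ⟨b, hb⟩ := Set.ncard_eq_one.1 hw
  have ha' : ∀ c, G.edge c ∈ P ∧ G.vert c = u ↔ c = a := fun c => Set.ext_iff.1 ha c
  have hb' : ∀ c, G.edge c ∈ P ∧ G.vert c = w ↔ c = b := fun c => Set.ext_iff.1 hb c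
  refine ⟨o.τ a, o.τ b, ⟨a, (ha' a).2 rfl⟩, fun c h1 h2 => by rw [(ha' c).1 ⟨h1, h2⟩],
    fun c h1 h2 => by rw [(hb' c).1 ⟨h1, h2⟩], ?_⟩
  have h1 := hx.sum_div_pos ⟨_, ((ha' a).2 rfl).1⟩
  classical
  rw [finsum_eq_finsetSum_of_support_subset (s := {u, w}), Finset.sum_pair huw] at h1
  · rwa [div, div, ha, hb, finsum_mem_singleton, finsum_mem_singleton] at h1
  · intro v hv
    by_contra hvn
    simp only [Finset.coe_insert, Finset.coe_singleton, Set.mem_insert_iff,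
      Set.mem_singleton_iff, not_or] at hvn
    apply hv
    by_cases hvC : v ∈ G.verts P
    · rcases o.balanced_or_of_degIn_eq_two (hin v hvC hvn.1 hvn.2) with h1 | h1
      · simp only
        rw [h1.2.1, zero_mul]
      · exact absurd (h v hvC hvn.1 hvn.2) h1.1
    · simp only
      rw [div_of_notMem_verts hvC, zero_mul]

/-- Ends of both signs at `v` in a union of two sets of edges, the second of which does not meet
`v`. -/
theorem Balanced.left {D : Set E} {v : V} (h : o.Balanced (C ∪ D) v) (hv : v ∉ G.verts D) :
    o.Balanced C v := by
  obtain ⟨⟨a, ha, rfl, hs⟩, b, hb, hbv, ht⟩ := h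
  refine ⟨⟨a, ha.resolve_right fun h => hv (mem_verts h), rfl, hs⟩,
    b, hb.resolve_right fun h => hv (hbv ▸ mem_verts h), hbv, ht⟩

theorem Balanced.mono {D : Set E} {v : V} (h : o.Balanced C v) (hCD : C ⊆ D) :
    o.Balanced D v := by
  obtain ⟨⟨a, ha, hav, hs⟩, b, hb, hbv, ht⟩ := h
  exact ⟨⟨a, hCD ha, hav, hs⟩, b, hCD hb, hbv, ht⟩

theorem Balanced.eq_neg {D : Set E} {v : V} (h : o.Balanced (C ∪ D) v) {s t : ℤˣ}
    (hs : ∀ a, G.edge a ∈ C → G.vert a = v → o.τ a = s)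
    (ht : ∀ a, G.edge a ∈ D → G.vert a = v → o.τ a = t) : s = -t := by
  have key : ∀ r : ℤˣ, ∃ a, G.edge a ∈ C ∪ D ∧ G.vert a = v ∧ o.τ a = r := fun r => by
    rcases Int.units_eq_one_or r with rfl | rfl
    · exact h.1
    · exact h.2
  by_contra hst
  have hst' : s = t := by
    rcases Int.units_eq_one_or s with rfl | rfl <;> rcases Int.units_eq_one_or t with rfl | rfl <;>
      simp_all
  obtain ⟨a, ha, hav, har⟩ := key (-s)
  have : o.τ a = s := by
    rcases ha with ha | ha
    · exact hs a ha hav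
    · rw [hst']
      exact ht a ha hav
  rw [har] at this
  rcases Int.units_eq_one_or s with rfl | rfl <;> exact absurd this (by decide)

/-- An orientation with a positive potential is acyclic. On a positive circle that is a cycle, the
values of a potential have sum zero. In a handcuff that is a cycle, each of the two figures fixes
the sign of a positive potential at its vertex of attachment: these signs contradict each other at a
common vertex, and otherwise make the sum of the values on the connecting path negative. -/
theorem Compat.isAcyclic [Finite V] [Finite E] [Finite I] (hx : o.Compat x) : o.IsAcyclic := by
  rintro C ⟨hC, hbal⟩
  replace hbal : ∀ v ∈ G.verts C, o.Balanced C v := hbal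
  rcases hC with ⟨e, rfl, he⟩ | ⟨hC, -⟩ | ⟨C₁, C₂, rfl, -, h1, h2, v, hv⟩ |
    ⟨C₁, C₂, P, u, w, rfl, h1, h2, hdisj, hP, hPu, hPw⟩
  · have := hx e
    rw [value_of_ends_eq_empty he] at this
    exact lt_irrefl _ this
  · have h2 := hx.sum_div_pos hC.1
    rw [finsum_eq_zero_of_forall_eq_zero] at h2
    · exact lt_irrefl _ h2
    intro v
    by_cases hvC : v ∈ G.verts C
    · rcases o.balanced_or_of_degIn_eq_two (hC.2.2.2 v hvC) with h1 | h1
      · rw [h1.2.1, zero_mul]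
      · exact absurd (hbal v hvC) h1.1
    · rw [div_of_notMem_verts hvC, zero_mul]
  · rw [verts_union] at hbal
    have hv' : v ∈ G.verts C₁ ∩ G.verts C₂ := hv ▸ rfl
    have hv1 : ∀ w ∈ G.verts C₁, w ∈ G.verts C₂ → w = v := fun w h1 h2 =>
      (Set.ext_iff.1 hv w).1 ⟨h1, h2⟩
    obtain ⟨s, hs, hs'⟩ := hx.pos_of_isUnbalancedFigure h1 hv'.1 fun w hw hwv =>
      (hbal w (Or.inl hw)).left fun h => hwv (hv1 w hw h)
    obtain ⟨t, ht, ht'⟩ := hx.pos_of_isUnbalancedFigure h2 hv'.2 fun w hw hwv =>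
      Balanced.left (Set.union_comm C₁ C₂ ▸ hbal w (Or.inr hw)) fun h => hwv (hv1 w h hw)
    rw [(hbal v (Or.inl hv'.1)).eq_neg hs ht] at hs'
    push_cast at hs'
    linarith
  · simp only [verts_union] at hbal
    have hu' : u ∈ G.verts P ∩ G.verts C₁ := hPu ▸ rfl
    have hw' : w ∈ G.verts P ∩ G.verts C₂ := hPw ▸ rfl
    have hu1 : ∀ v ∈ G.verts P, v ∈ G.verts C₁ → v = u := fun w h1 h2 =>
      (Set.ext_iff.1 hPu w).1 ⟨h1, h2⟩
    have hw1 : ∀ v ∈ G.verts P, v ∈ G.verts C₂ → v = w := fun w h1 h2 =>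
      (Set.ext_iff.1 hPw w).1 ⟨h1, h2⟩
    have hd : ∀ v ∈ G.verts C₁, v ∉ G.verts C₂ := fun v h1 h2 => Set.disjoint_left.1 hdisj h1 h2
    have b1 : ∀ v ∈ G.verts C₁, o.Balanced (C₁ ∪ P) v := fun v hv => by
      have := hbal v (Or.inl (Or.inl hv))
      rw [Set.union_right_comm] at this
      exact this.left (hd v hv)
    have b2 : ∀ v ∈ G.verts C₂, o.Balanced (C₂ ∪ P) v := fun v hv => by
      have := hbal v (Or.inl (Or.inr hv))
      rw [Set.union_comm C₁ C₂, Set.union_right_comm] at this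
      exact this.left fun h => hd v h hv
    have b3 : ∀ v ∈ G.verts P, v ≠ u → v ≠ w → o.Balanced P v := fun v hv hvu hvw => by
      have := hbal v (Or.inr hv)
      rw [Set.union_comm] at this
      refine this.left ?_
      rw [verts_union]
      rintro (h | h)
      · exact hvu (hu1 v hv h)
      · exact hvw (hw1 v hv h)
    obtain ⟨s, hs, hs'⟩ := hx.pos_of_isUnbalancedFigure h1 hu'.2 fun v hv hvu =>
      (b1 v hv).left fun h => hvu (hu1 v h hv)
    obtain ⟨t, ht, ht'⟩ := hx.pos_of_isUnbalancedFigure h2 hw'.2 fun v hv hvu =>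
      (b2 v hv).left fun h => hvu (hw1 v h hv)
    obtain ⟨p, q, -, hp, hq, hpq⟩ := hx.pos_of_isPath hP b3
    rw [(b1 u hu'.2).eq_neg hs hp] at hs'
    rw [(b2 w hw'.2).eq_neg ht hq] at ht'
    push_cast at hs' ht'
    linarith

end Orientation

end SignedGraph

/-! ### Directed paths and lassos -/

namespace SignedGraph

variable {V E I : Type*} {G : SignedGraph V E I}

theorem units_eq_or_eq_neg (s t : ℤˣ) : s = t ∨ s = -t := by
  rcases Int.units_eq_one_or s with rfl | rfl <;> rcases Int.units_eq_one_or t with rfl | rfl <;>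
    simp

theorem units_ne_neg (s : ℤˣ) : s ≠ -s := by
  rcases Int.units_eq_one_or s with rfl | rfl <;> decide

theorem eq_or_eq_of_edge_eq {a b c : I} (hab : a ≠ b) (h : G.edge a = G.edge b)
    (hc : G.edge c = G.edge a) : c = a ∨ c = b :=
  (Set.ext_iff.1 (ends_eq_pair hab h) c).1 hc

theorem verts_singleton_of_link {a b : I} (hab : a ≠ b) (h : G.edge a = G.edge b) :
    G.verts {G.edge a} = {G.vert a, G.vert b} := by
  ext v
  constructor
  · rintro ⟨c, hc, rfl⟩
    rcases eq_or_eq_of_edge_eq hab h hc with rfl | rfl <;> simp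
  · rintro (rfl | rfl)
    · exact mem_verts rfl
    · exact mem_verts h.symm

theorem verts_singleton_of_halfEdge {a : I} (h : G.ends (G.edge a) = {a}) :
    G.verts {G.edge a} = {G.vert a} := by
  ext v
  constructor
  · rintro ⟨c, hc, rfl⟩
    rw [(Set.ext_iff.1 h c).1 hc]
    rfl
  · rintro rfl
    exact mem_verts rfl

theorem encard_ends_of_link {a b : I} (hab : a ≠ b) (h : G.edge a = G.edge b) :
    (G.ends (G.edge a)).encard = 2 := by
  rw [ends_eq_pair hab h, Set.encard_pair hab]

theorem connectedEdges_singleton (e : E) : G.ConnectedEdges {e} := by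
  rintro D hD ⟨d, hd⟩ ⟨c, hc, hc'⟩
  rw [Set.mem_singleton_iff.1 (hD hd)] at hd
  rw [Set.mem_singleton_iff.1 hc] at hc'
  exact absurd hd hc'

theorem ConnectedEdges.union {P Q : Set E} (hP : G.ConnectedEdges P) (hQ : G.ConnectedEdges Q)
    (h : (G.verts P ∩ G.verts Q).Nonempty) : G.ConnectedEdges (P ∪ Q) := by
  intro D hD hD1 hD2
  -- if `D` splits neither `P` nor `Q`, then it is one of them
  have split : ∀ R ⊆ P ∪ Q, G.ConnectedEdges R → (R ∩ D).Nonempty → (R \ D).Nonempty →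
      (G.verts D ∩ G.verts ((P ∪ Q) \ D)).Nonempty := by
    intro R hR hRc h1 h2
    have h3 : R \ (R ∩ D) = R \ D := by
      ext
      simp
    obtain ⟨v, hv1, hv2⟩ := hRc (R ∩ D) Set.inter_subset_left h1 (h3 ▸ h2)
    refine ⟨v, verts_mono Set.inter_subset_right hv1, verts_mono ?_ (h3 ▸ hv2)⟩
    exact Set.sdiff_subset_sdiff_left hR
  by_cases hP1 : (P ∩ D).Nonempty
  · by_cases hP2 : (P \ D).Nonempty
    · exact split P Set.subset_union_left hP hP1 hP2
    by_cases hQ1 : (Q ∩ D).Nonempty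
    · by_cases hQ2 : (Q \ D).Nonempty
      · exact split Q Set.subset_union_right hQ hQ1 hQ2
      · obtain ⟨e, he | he, heD⟩ := hD2
        · exact absurd ⟨e, he, heD⟩ hP2
        · exact absurd ⟨e, he, heD⟩ hQ2
    · obtain ⟨v, hv1, hv2⟩ := h
      have h1 : P ⊆ D := fun e he => by
        by_contra heD
        exact hP2 ⟨e, he, heD⟩
      have h2 : Q ⊆ (P ∪ Q) \ D := fun e he => ⟨Or.inr he, fun heD => hQ1 ⟨e, he, heD⟩⟩
      exact ⟨v, verts_mono h1 hv1, verts_mono h2 hv2⟩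
  · by_cases hQ2 : (Q \ D).Nonempty
    · by_cases hQ1 : (Q ∩ D).Nonempty
      · exact split Q Set.subset_union_right hQ hQ1 hQ2
      · obtain ⟨e, he⟩ := hD1
        rcases hD he with h1 | h1
        · exact absurd ⟨e, h1, he⟩ hP1
        · exact absurd ⟨e, h1, he⟩ hQ1
    · obtain ⟨v, hv1, hv2⟩ := h
      have h1 : Q ⊆ D := fun e he => by
        by_contra heD
        exact hQ2 ⟨e, he, heD⟩
      have h2 : P ⊆ (P ∪ Q) \ D := fun e he => ⟨Or.inl he, fun heD => hP1 ⟨e, he, heD⟩⟩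
      exact ⟨v, verts_mono h1 hv2, verts_mono h2 hv1⟩

theorem degIn_union_of_notMem {P Q : Set E} {v : V} (h : v ∉ G.verts Q) :
    G.degIn (P ∪ Q) v = G.degIn P v := by
  rw [degIn, degIn]
  congr 1
  ext a
  constructor
  · rintro ⟨h1 | h1, rfl⟩
    · exact ⟨h1, rfl⟩
    · exact absurd (mem_verts h1) h
  · rintro ⟨h1, rfl⟩
    exact ⟨Or.inl h1, rfl⟩

theorem degIn_union_eq_two {P Q : Set E} {v : V} {a b : I} (hab : a ≠ b)
    (ha : {c | G.edge c ∈ P ∧ G.vert c = v} = {a}) (hb : {c | G.edge c ∈ Q ∧ G.vert c = v} = {b}) :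
    G.degIn (P ∪ Q) v = 2 := by
  rw [degIn, ← Set.ncard_pair hab, ← Set.singleton_union, ← ha, ← hb]
  congr 1
  ext c
  simp only [Set.mem_union, Set.mem_ofPred_eq]
  tauto

theorem IsPath.symm {P : Set E} {u v : V} (h : G.IsPath P u v) : G.IsPath P v u :=
  ⟨h.1.symm, h.2.1, h.2.2.1, h.2.2.2.2.1, h.2.2.2.1,
    fun w hw hwu hwv => h.2.2.2.2.2 w hw hwv hwu⟩

namespace Orientation

variable {o : G.Orientation}

theorem balanced_of_signs {C : Set E} {v : V} {s : ℤˣ}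
    (h : ∃ a, G.edge a ∈ C ∧ G.vert a = v ∧ o.τ a = s)
    (h' : ∃ a, G.edge a ∈ C ∧ G.vert a = v ∧ o.τ a = -s) : o.Balanced C v := by
  rcases Int.units_eq_one_or s with rfl | rfl
  · exact ⟨h, h'⟩
  · exact ⟨by simpa using h', h⟩

theorem Balanced.exists_sign {C : Set E} {v : V} (h : o.Balanced C v) (s : ℤˣ) :
    ∃ a, G.edge a ∈ C ∧ G.vert a = v ∧ o.τ a = s := by
  rcases Int.units_eq_one_or s with rfl | rfl
  · exact h.1
  · exact h.2

variable (o)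

/-- A path from `u` to `v` without inner sources and sinks; `s` and `t` are the signs of its ends
at `u` and `v`. The notion is symmetric in the two end points. -/
structure Strand (P : Set E) (u : V) (s : ℤˣ) (v : V) (t : ℤˣ) : Prop where
  isPath : G.IsPath P u v
  left : ∀ a, G.edge a ∈ P → G.vert a = u → o.τ a = s
  right : ∀ a, G.edge a ∈ P → G.vert a = v → o.τ a = t
  balanced : ∀ w ∈ G.verts P, w ≠ u → w ≠ v → o.Balanced P w

variable {o}

namespace Strand

variable {P Q : Set E} {u v w : V} {s t r : ℤˣ}

theorem symm (h : o.Strand P u s v t) : o.Strand P v t u s :=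
  ⟨h.isPath.symm, h.right, h.left, fun w hw hwv hwu => h.balanced w hw hwu hwv⟩

theorem exists_left (h : o.Strand P u s v t) :
    ∃ a, {c | G.edge c ∈ P ∧ G.vert c = u} = {a} ∧ G.edge a ∈ P ∧ G.vert a = u ∧ o.τ a = s := by
  obtain ⟨a, ha⟩ := Set.ncard_eq_one.1 h.isPath.2.2.2.1
  have h1 := (Set.ext_iff.1 ha a).2 rfl
  exact ⟨a, ha, h1.1, h1.2, h.left a h1.1 h1.2⟩

theorem left_mem (h : o.Strand P u s v t) : u ∈ G.verts P := by
  obtain ⟨a, -, ha, rfl, -⟩ := h.exists_left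
  exact mem_verts ha

theorem right_mem (h : o.Strand P u s v t) : v ∈ G.verts P := h.symm.left_mem

theorem single {a b : I} (hab : a ≠ b) (h : G.edge a = G.edge b) (hv : G.vert a ≠ G.vert b) :
    o.Strand {G.edge a} (G.vert a) (o.τ a) (G.vert b) (o.τ b) := by
  have ha : ∀ c, G.edge c ∈ ({G.edge a} : Set E) → G.vert c = G.vert a → c = a := by
    intro c hc hc'
    rcases eq_or_eq_of_edge_eq hab h hc with rfl | rfl
    · rfl
    · exact absurd hc'.symm hv
  have hb : ∀ c, G.edge c ∈ ({G.edge a} : Set E) → G.vert c = G.vert b → c = b := by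
    intro c hc hc'
    rcases eq_or_eq_of_edge_eq hab h hc with rfl | rfl
    · exact absurd hc' hv
    · rfl
  have hvert : ∀ w ∈ G.verts {G.edge a}, w = G.vert a ∨ w = G.vert b := fun w hw => by
    rwa [verts_singleton_of_link hab h] at hw
  refine ⟨⟨hv, connectedEdges_singleton _, ?_, ?_, ?_, ?_⟩, ?_, ?_, ?_⟩
  · rintro e rfl
    exact encard_ends_of_link hab h
  · refine Set.ncard_eq_one.2 ⟨a, Set.eq_singleton_iff_unique_mem.2 ⟨⟨rfl, rfl⟩, ?_⟩⟩
    exact fun c hc => ha c hc.1 hc.2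
  · refine Set.ncard_eq_one.2 ⟨b, Set.eq_singleton_iff_unique_mem.2 ⟨⟨h.symm, rfl⟩, ?_⟩⟩
    exact fun c hc => hb c hc.1 hc.2
  · intro w hw h1 h2
    exact absurd (hvert w hw) (by tauto)
  · exact fun c hc hc' => by rw [ha c hc hc']
  · exact fun c hc hc' => by rw [hb c hc hc']
  · intro w hw h1 h2
    exact absurd (hvert w hw) (by tauto)

theorem trans (hP : o.Strand P u s v t) (hQ : o.Strand Q v (-t) w r)
    (h : ∀ z ∈ G.verts P, z ∈ G.verts Q → z = v) : o.Strand (P ∪ Q) u s w r := by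
  have huv : u ≠ v := hP.isPath.1
  have hvw : v ≠ w := hQ.isPath.1
  have hu : u ∉ G.verts Q := fun hu => huv (h u hP.left_mem hu)
  have hw : w ∉ G.verts P := fun hw => hvw (h w hw hQ.right_mem).symm
  have huw : u ≠ w := fun e => hu (e ▸ hQ.right_mem)
  obtain ⟨a, ha, haP, hav, hat⟩ := hP.symm.exists_left
  obtain ⟨b, hb, hbQ, hbv, hbt⟩ := hQ.exists_left
  have hab : a ≠ b := by
    rintro rfl
    exact units_ne_neg t (hat.symm.trans hbt)
  refine ⟨⟨huw, hP.isPath.2.1.union hQ.isPath.2.1 ⟨v, hP.right_mem, hQ.left_mem⟩, ?_, ?_, ?_, ?_⟩,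
    ?_, ?_, ?_⟩
  · rintro e (he | he)
    · exact hP.isPath.2.2.1 e he
    · exact hQ.isPath.2.2.1 e he
  · rw [degIn_union_of_notMem hu]
    exact hP.isPath.2.2.2.1
  · rw [Set.union_comm, degIn_union_of_notMem hw]
    exact hQ.isPath.2.2.2.2.1
  · intro z hz hzu hzw
    by_cases hzv : z = v
    · subst hzv
      exact degIn_union_eq_two hab ha hb
    rw [verts_union] at hz
    rcases hz with hz | hz
    · rw [degIn_union_of_notMem fun hz' => hzv (h z hz hz')]
      exact hP.isPath.2.2.2.2.2 z hz hzu hzv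
    · rw [Set.union_comm, degIn_union_of_notMem fun hz' => hzv (h z hz' hz)]
      exact hQ.isPath.2.2.2.2.2 z hz hzv hzw
  · rintro c (hc | hc) hcu
    · exact hP.left c hc hcu
    · exact absurd (hcu ▸ mem_verts hc) hu
  · rintro c (hc | hc) hcw
    · exact absurd (hcw ▸ mem_verts hc) hw
    · exact hQ.right c hc hcw
  · intro z hz hzu hzw
    by_cases hzv : z = v
    · subst hzv
      exact balanced_of_signs ⟨a, Or.inl haP, hav, hat⟩ ⟨b, Or.inr hbQ, hbv, hbt⟩
    rw [verts_union] at hz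
    rcases hz with hz | hz
    · exact (hP.balanced z hz hzu hzv).mono Set.subset_union_left
    · exact (hQ.balanced z hz hzv hzw).mono Set.subset_union_right

/-- Two strands with the same end points and no other common vertex, whose signs are opposite at
one end point, form a circle. -/
theorem isCircle (hP : o.Strand P u s v t) (hQ : o.Strand Q u r v (-t))
    (h : ∀ z ∈ G.verts P, z ∈ G.verts Q → z = u ∨ z = v) :
    G.IsCircle (P ∪ Q) ∧ ∀ w ∈ G.verts (P ∪ Q), w ≠ u → o.Balanced (P ∪ Q) w := by
  obtain ⟨a, ha, haP, hau, has⟩ := hP.exists_left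
  obtain ⟨b, hb, hbQ, hbu, hbr⟩ := hQ.exists_left
  obtain ⟨c, hc, hcP, hcv, hct⟩ := hP.symm.exists_left
  obtain ⟨d, hd, hdQ, hdv, hdt⟩ := hQ.symm.exists_left
  have hcd : c ≠ d := by
    rintro rfl
    exact units_ne_neg t (hct.symm.trans hdt)
  have hab : a ≠ b := by
    rintro rfl
    -- the other end of a common edge of the two strands would have both signs at `v`
    obtain ⟨x, y, hxy, hx⟩ := Set.encard_eq_two.1 (hP.isPath.2.2.1 _ haP)
    obtain ⟨z, hza, hz⟩ : ∃ z, z ≠ a ∧ G.edge z = G.edge a := by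
      obtain ⟨h1, h2⟩ := edge_eq_of_ends_eq_pair hx
      by_cases hxa : x = a
      · exact ⟨y, fun hy => hxy (hxa.trans hy.symm), h2⟩
      · exact ⟨x, hxa, h1⟩
    have hzP : G.edge z ∈ P := hz ▸ haP
    have hzQ : G.edge z ∈ Q := hz ▸ hbQ
    rcases h _ (mem_verts hzP) (mem_verts hzQ) with h1 | h1
    · exact hza ((Set.ext_iff.1 ha z).1 ⟨hzP, h1⟩)
    · exact units_ne_neg t ((hP.right z hzP h1).symm.trans (hQ.right z hzQ h1))
  refine ⟨⟨⟨_, Or.inl haP⟩, hP.isPath.2.1.union hQ.isPath.2.1 ⟨v, hP.right_mem, hQ.right_mem⟩,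
    ?_, ?_⟩, ?_⟩
  · rintro e (he | he)
    · exact hP.isPath.2.2.1 e he
    · exact hQ.isPath.2.2.1 e he
  · intro z hz
    by_cases hzu : z = u
    · subst hzu
      exact degIn_union_eq_two hab ha hb
    by_cases hzv : z = v
    · subst hzv
      exact degIn_union_eq_two hcd hc hd
    rw [verts_union] at hz
    rcases hz with hz | hz
    · rw [degIn_union_of_notMem fun hz' => (h z hz hz').elim hzu hzv]
      exact hP.isPath.2.2.2.2.2 z hz hzu hzv
    · rw [Set.union_comm, degIn_union_of_notMem fun hz' => (h z hz' hz).elim hzu hzv]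
      exact hQ.isPath.2.2.2.2.2 z hz hzu hzv
  · intro z hz hzu
    by_cases hzv : z = v
    · subst hzv
      exact balanced_of_signs ⟨c, Or.inl hcP, hcv, hct⟩ ⟨d, Or.inr hdQ, hdv, hdt⟩
    rw [verts_union] at hz
    rcases hz with hz | hz
    · exact (hP.balanced z hz hzu hzv).mono Set.subset_union_left
    · exact (hQ.balanced z hz hzu hzv).mono Set.subset_union_right

/-- In an acyclic orientation, two strands cannot form a circle without sources and sinks. -/
theorem not_isAcyclic [Finite E] [Finite I] (hP : o.Strand P u s v t)
    (hQ : o.Strand Q u (-s) v (-t)) (h : ∀ z ∈ G.verts P, z ∈ G.verts Q → z = u ∨ z = v) :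
    ¬ o.IsAcyclic := by
  intro ho
  obtain ⟨hC, hbal⟩ := hP.isCircle hQ h
  have hbal' : ∀ w ∈ G.verts (P ∪ Q), o.Balanced (P ∪ Q) w := by
    intro w hw
    by_cases hwu : w = u
    · obtain ⟨a, -, haP, hau, has⟩ := hP.exists_left
      obtain ⟨b, -, hbQ, hbu, hbr⟩ := hQ.exists_left
      rw [hwu]
      exact balanced_of_signs ⟨a, Or.inl haP, hau, has⟩ ⟨b, Or.inr hbQ, hbu, hbr⟩
    · exact hbal w hw hwu
  exact ho _ ⟨Or.inr (Or.inl ⟨hC, hC.signProd_eq_one hbal'⟩), hbal'⟩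

end Strand

variable (o)

/-- Paths in `S` that start at `u` along an end of sign `s`, built edge by edge: each new edge
leaves the last vertex with the sign opposite to that of the arrival, and leads to a new vertex.
`DirPath o S u s P v t` says that `P` is the edge set of such a path which arrives at `v` with the
sign `t`. -/
inductive DirPath (S : Set E) (u : V) (s : ℤˣ) : Set E → V → ℤˣ → Prop
  | single {a b : I} (hab : a ≠ b) (h : G.edge a = G.edge b) (hv : G.vert a ≠ G.vert b)
      (hS : G.edge a ∈ S) (hu : G.vert a = u) (hs : o.τ a = s) :
      DirPath S u s {G.edge a} (G.vert b) (o.τ b)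
  | snoc {P : Set E} {v : V} {t : ℤˣ} {a b : I} (hP : DirPath S u s P v t) (hab : a ≠ b)
      (h : G.edge a = G.edge b) (hS : G.edge a ∈ S) (hv : G.vert a = v) (ht : o.τ a = -t)
      (hb : G.vert b ∉ G.verts P) : DirPath S u s (P ∪ {G.edge a}) (G.vert b) (o.τ b)

variable {o}

namespace DirPath

variable {S P : Set E} {u v w : V} {s t : ℤˣ}

theorem strand (hP : o.DirPath S u s P v t) : o.Strand P u s v t := by
  induction hP with
  | single hab h hv hS hu hs =>
    subst hu hs
    exact Strand.single hab h hv
  | snoc hP hab h hS hv ht hb ih =>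
    subst hv
    refine ih.trans (ht ▸ Strand.single hab h fun e => hb (e ▸ ih.right_mem)) fun z hz hz' => ?_
    rw [verts_singleton_of_link hab h] at hz'
    rcases hz' with rfl | rfl
    · rfl
    · exact absurd hz hb

theorem subset (hP : o.DirPath S u s P v t) : P ⊆ S := by
  induction hP with
  | single hab h hv hS hu hs => exact Set.singleton_subset_iff.2 hS
  | snoc hP hab h hS hv ht hb ih => exact Set.union_subset ih (Set.singleton_subset_iff.2 hS)

theorem split (hP : o.DirPath S u s P v t) : ∀ w ∈ G.verts P, w ≠ u → w ≠ v →
    ∃ P₁ P₂ r, o.DirPath S u s P₁ w r ∧ o.DirPath S w (-r) P₂ v t ∧ P = P₁ ∪ P₂ ∧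
      ∀ z ∈ G.verts P₁, z ∈ G.verts P₂ → z = w := by
  induction hP with
  | single hab h hv hS hu hs =>
    intro w hw hwu hwv
    rw [verts_singleton_of_link hab h] at hw
    rcases hw with rfl | rfl
    · exact absurd hu hwu
    · exact absurd rfl hwv
  | @snoc P v t a b hP hab h hS hv ht hb ih =>
    intro w hw hwu hwb
    by_cases hwv : w = v
    · subst hwv
      refine ⟨P, {G.edge a}, t, hP, ?_, rfl, fun z hz hz' => ?_⟩
      · exact single hab h (fun e => hb (e ▸ hv ▸ hP.strand.right_mem)) hS hv ht
      · rw [verts_singleton_of_link hab h] at hz'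
        rcases hz' with rfl | rfl
        · exact hv
        · exact absurd hz hb
    · have hwP : w ∈ G.verts P := by
        rw [verts_union, verts_singleton_of_link hab h] at hw
        rcases hw with hw | rfl | rfl
        · exact hw
        · exact absurd hv hwv
        · exact absurd rfl hwb
      obtain ⟨P₁, P₂, r, h1, h2, rfl, h3⟩ := ih w hwP hwu hwv
      rw [verts_union] at hb
      refine ⟨P₁, P₂ ∪ {G.edge a}, r, h1, h2.snoc hab h hS hv ht fun hb' => hb (Or.inr hb'),
        Set.union_assoc _ _ _, fun z hz hz' => ?_⟩
      rw [verts_union, verts_singleton_of_link hab h] at hz'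
      rcases hz' with hz' | rfl | rfl
      · exact h3 z hz hz'
      · exact h3 _ hz (hv ▸ h2.strand.right_mem)
      · exact absurd (Or.inl hz) hb

end DirPath

variable (o)

/-- An unbalanced figure in `S` all of whose vertices but `v` are neither sources nor sinks of it,
and whose ends at `v` have the sign `s`. Every other vertex can be reached from `v` inside the
figure, and can be arrived at with either sign. -/
structure Figure (S C : Set E) (v : V) (s : ℤˣ) : Prop where
  subset : C ⊆ S
  isUnbalancedFigure : G.IsUnbalancedFigure C
  mem : v ∈ G.verts C
  sign : ∀ a, G.edge a ∈ C → G.vert a = v → o.τ a = s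
  balanced : ∀ w ∈ G.verts C, w ≠ v → o.Balanced C w
  arc : ∀ w ∈ G.verts C, w ≠ v → ∀ r, ∃ A ⊆ C, o.Strand A v s w r

variable {o} {S : Set E}

theorem figure_of_halfEdge {a : I} (ha : G.ends (G.edge a) = {a}) (hS : G.edge a ∈ S) :
    o.Figure S {G.edge a} (G.vert a) (o.τ a) := by
  have hv : ∀ w ∈ G.verts {G.edge a}, w = G.vert a := fun w hw => by
    rwa [verts_singleton_of_halfEdge ha] at hw
  refine ⟨Set.singleton_subset_iff.2 hS, Or.inr ⟨_, rfl, Set.encard_eq_one.2 ⟨a, ha⟩⟩,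
    mem_verts rfl, fun c hc _ => ?_, fun w hw hwv => absurd (hv w hw) hwv,
    fun w hw hwv => absurd (hv w hw) hwv⟩
  rw [(Set.ext_iff.1 ha c).1 hc]

theorem not_balanced_of_sign {C : Set E} {v : V} {s : ℤˣ}
    (h : ∀ a, G.edge a ∈ C → G.vert a = v → o.τ a = s) : ¬ o.Balanced C v := by
  intro hb
  obtain ⟨a, ha, hav, has⟩ := hb.exists_sign (-s)
  exact units_ne_neg s ((h a ha hav).symm.trans has)

theorem figure_of_loop [Finite E] [Finite I] (ho : o.IsAcyclic) {a b : I} (hab : a ≠ b)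
    (h : G.edge a = G.edge b) (hv : G.vert a = G.vert b) (hS : G.edge a ∈ S) :
    o.Figure S {G.edge a} (G.vert a) (o.τ a) := by
  have hvert : ∀ w ∈ G.verts {G.edge a}, w = G.vert a := fun w hw => by
    rw [verts_singleton_of_link hab h, ← hv] at hw
    simpa using hw
  have hC : G.IsCircle {G.edge a} := by
    refine ⟨Set.singleton_nonempty _, connectedEdges_singleton _, ?_, ?_⟩
    · rintro e rfl
      exact encard_ends_of_link hab h
    · intro w hw
      rw [hvert w hw, degIn, ← Set.ncard_pair hab, ← ends_eq_pair hab h]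
      congr 1
      ext c
      constructor
      · exact fun hc => hc.1
      · intro hc
        refine ⟨hc, ?_⟩
        rcases eq_or_eq_of_edge_eq hab h hc with rfl | rfl
        · rfl
        · exact hv.symm
  have hτ : o.τ b = o.τ a := by
    rcases units_eq_or_eq_neg (o.τ b) (o.τ a) with h1 | h1
    · exact h1
    · have hbal : ∀ w ∈ G.verts {G.edge a}, o.Balanced {G.edge a} w := fun w hw => by
        rw [hvert w hw]
        exact balanced_of_signs ⟨a, rfl, rfl, rfl⟩ ⟨b, h.symm, hv.symm, h1⟩
      exact absurd ⟨Or.inr (Or.inl ⟨hC, hC.signProd_eq_one hbal⟩), hbal⟩ (ho {G.edge a})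
  have hsign : ∀ c, G.edge c ∈ ({G.edge a} : Set E) → G.vert c = G.vert a → o.τ c = o.τ a := by
    intro c hc _
    rcases eq_or_eq_of_edge_eq hab h hc with rfl | rfl
    · rfl
    · exact hτ
  exact ⟨Set.singleton_subset_iff.2 hS, Or.inl ⟨hC, hC.signProd_eq_neg_one (mem_verts rfl)
    (not_balanced_of_sign hsign) fun w hw hwv => absurd (hvert w hw) hwv⟩, mem_verts rfl, hsign,
    fun w hw hwv => absurd (hvert w hw) hwv, fun w hw hwv => absurd (hvert w hw) hwv⟩

/-- In an acyclic orientation, a directed path that returns to its first vertex is a negative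
circle with a source or a sink there. -/
theorem figure_of_closed [Finite E] [Finite I] (ho : o.IsAcyclic) {P : Set E} {u v : V} {s t : ℤˣ}
    (hP : o.DirPath S u s P v t) {a b : I} (hab : a ≠ b) (h : G.edge a = G.edge b)
    (hS : G.edge a ∈ S) (hv : G.vert a = v) (ht : o.τ a = -t) (hb : G.vert b = u) :
    o.Figure S (P ∪ {G.edge a}) u s := by
  have hvb : G.vert b ≠ G.vert a := by
    rw [hv, hb]
    exact hP.strand.isPath.1
  have hvert : ∀ z ∈ G.verts {G.edge a}, z = u ∨ z = v := fun z hz => by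
    rw [verts_singleton_of_link hab h, hv, hb] at hz
    exact hz.symm
  have hQ : o.Strand {G.edge a} u (o.τ b) v (-t) := by
    have := Strand.single (o := o) hab.symm h.symm hvb
    rwa [hv, hb, ht, ← h] at this
  have hτ : o.τ b = s := by
    rcases units_eq_or_eq_neg (o.τ b) s with h1 | h1
    · exact h1
    · exact absurd ho (hP.strand.not_isAcyclic (h1 ▸ hQ) fun z _ hz => hvert z hz)
  rw [hτ] at hQ
  obtain ⟨hC, hbal⟩ := hP.strand.isCircle hQ fun z _ hz => hvert z hz
  have hu : u ∈ G.verts (P ∪ {G.edge a}) := verts_mono Set.subset_union_left hP.strand.left_mem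
  have hsign : ∀ c, G.edge c ∈ P ∪ {G.edge a} → G.vert c = u → o.τ c = s := by
    rintro c (hc | hc) hcu
    · exact hP.strand.left c hc hcu
    · exact hQ.left c hc hcu
  refine ⟨Set.union_subset hP.subset (Set.singleton_subset_iff.2 hS),
    Or.inl ⟨hC, hC.signProd_eq_neg_one hu (not_balanced_of_sign hsign) hbal⟩, hu, hsign, hbal, ?_⟩
  intro w hw hwu r
  by_cases hwv : w = v
  · subst hwv
    rcases units_eq_or_eq_neg r t with rfl | rfl
    · exact ⟨P, Set.subset_union_left, hP.strand⟩
    · exact ⟨_, Set.subset_union_right, hQ⟩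
  · have hwP : w ∈ G.verts P := by
      rw [verts_union] at hw
      exact hw.resolve_right fun hw => (hvert w hw).elim hwu hwv
    obtain ⟨P₁, P₂, q, h1, h2, rfl, h3⟩ := hP.split w hwP hwu hwv
    rcases units_eq_or_eq_neg r q with rfl | rfl
    · exact ⟨P₁, Set.subset_union_left.trans Set.subset_union_left, h1.strand⟩
    · have := (h2.snoc hab h hS hv ht fun hb' =>
        hwu (h3 u h1.strand.left_mem (hb ▸ hb')).symm).strand.symm
      rw [hb, hτ] at this
      exact ⟨_, Set.union_subset_union_left _ Set.subset_union_right, this⟩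

/-- The possible outcomes of a directed walk in `S` that starts at `u` with sign `s` and is stopped
when it meets the set `X` or revisits a vertex: a figure at `u`, a path with a figure at its last
vertex, or a path that ends in `X`. -/
def Lasso (o : G.Orientation) (S : Set E) (X : Set V) (u : V) (s : ℤˣ) : Prop :=
  (∃ C, o.Figure S C u s ∧ ∀ z ∈ G.verts C, z ≠ u → z ∉ X) ∨
  (∃ P w r C, o.DirPath S u s P w r ∧ o.Figure S C w (-r) ∧
    (∀ z ∈ G.verts P, z ∈ G.verts C → z = w) ∧ (∀ z ∈ G.verts P, z ≠ u → z ∉ X) ∧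
    ∀ z ∈ G.verts C, z ≠ u → z ∉ X) ∨
  (∃ P w r, o.DirPath S u s P w r ∧ w ∈ X ∧ ∀ z ∈ G.verts P, z ≠ u → z ≠ w → z ∉ X)

theorem lasso_of_dirPath [Finite V] [Finite E] [Finite I] (ho : o.IsAcyclic)
    (hbal : ∀ v ∈ G.verts S, o.Balanced S v) (X : Set V) {u : V} {s : ℤˣ} (m : ℕ) :
    ∀ {P : Set E} {v : V} {t : ℤˣ}, o.DirPath S u s P v t → (∀ z ∈ G.verts P, z ≠ u → z ∉ X) →
      Nat.card V < (G.verts P).ncard + m → o.Lasso S X u s := by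
  induction m with
  | zero =>
    intro P v t _ _ hm
    exact absurd (Set.ncard_le_card (G.verts P)) (by omega)
  | succ m ih =>
    intro P v t hP hX hm
    obtain ⟨a, haS, hav, hat⟩ :=
      (hbal v (verts_mono hP.subset hP.strand.right_mem)).exists_sign (-t)
    have hvX := hX v hP.strand.right_mem hP.strand.isPath.1.symm
    rcases (G.ends (G.edge a)).eq_singleton_or_nontrivial rfl with ha | ha
    · have hF := figure_of_halfEdge (o := o) ha haS
      rw [hav, hat] at hF
      have hC : ∀ z ∈ G.verts {G.edge a}, z = v := fun z hz => by
        rwa [verts_singleton_of_halfEdge ha, hav] at hz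
      exact Or.inr (Or.inl ⟨P, v, t, _, hP, hF, fun z _ hz => hC z hz, hX,
        fun z hz _ => hC z hz ▸ hvX⟩)
    · obtain ⟨b, hb, hba⟩ := ha.exists_ne a
      have h : G.edge a = G.edge b := Eq.symm hb
      by_cases hvb : G.vert a = G.vert b
      · have hF := figure_of_loop (S := S) ho hba.symm h hvb haS
        rw [hav, hat] at hF
        have hC : ∀ z ∈ G.verts {G.edge a}, z = v := fun z hz => by
          rw [verts_singleton_of_link hba.symm h, ← hvb, hav] at hz
          simpa using hz
        exact Or.inr (Or.inl ⟨P, v, t, _, hP, hF, fun z _ hz => hC z hz, hX,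
          fun z hz _ => hC z hz ▸ hvX⟩)
      have hvert : ∀ z ∈ G.verts {G.edge a}, z = v ∨ z = G.vert b := fun z hz => by
        rwa [verts_singleton_of_link hba.symm h, hav] at hz
      by_cases hbP : G.vert b ∈ G.verts P
      · by_cases hbu : G.vert b = u
        · refine Or.inl ⟨_, figure_of_closed ho hP hba.symm h haS hav hat hbu, fun z hz hzu => ?_⟩
          rw [verts_union] at hz
          rcases hz with hz | hz
          · exact hX z hz hzu
          · rcases hvert z hz with rfl | rfl
            · exact hvX
            · exact absurd hbu hzu
        · obtain ⟨P₁, P₂, r, h1, h2, rfl, h3⟩ := hP.split _ hbP hbu fun e => hvb (hav.trans e.symm)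
          have hsub : ∀ z ∈ G.verts (P₂ ∪ {G.edge a}), z ∈ G.verts P₂ := fun z hz => by
            rw [verts_union] at hz
            rcases hz with hz | hz
            · exact hz
            · rcases hvert z hz with rfl | rfl
              · exact h2.strand.right_mem
              · exact h2.strand.left_mem
          rw [verts_union] at hX
          exact Or.inr (Or.inl ⟨P₁, _, r, _, h1, figure_of_closed ho h2 hba.symm h haS hav hat rfl,
            fun z hz hz' => h3 z hz (hsub z hz'), fun z hz => hX z (Or.inl hz),
            fun z hz => hX z (Or.inr (hsub z hz))⟩)
      · have hP' := hP.snoc hba.symm h haS hav hat hbP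
        have hverts : G.verts (P ∪ {G.edge a}) = insert (G.vert b) (G.verts P) := by
          rw [verts_union, verts_singleton_of_link hba.symm h, hav]
          ext z
          have := hP.strand.right_mem
          simp only [Set.mem_union, Set.mem_insert_iff, Set.mem_singleton_iff]
          constructor
          · rintro (hz | rfl | rfl)
            · exact Or.inr hz
            · exact Or.inr this
            · exact Or.inl rfl
          · tauto
        by_cases hbX : G.vert b ∈ X
        · refine Or.inr (Or.inr ⟨_, _, _, hP', hbX, fun z hz hzu hzb => ?_⟩)
          rw [hverts] at hz
          exact hX z (hz.resolve_left hzb) hzu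
        · refine ih hP' (fun z hz hzu => ?_) ?_
          · rw [hverts] at hz
            rcases hz with rfl | hz
            · exact hbX
            · exact hX z hz hzu
          · rw [hverts, Set.ncard_insert_of_notMem hbP]
            omega

theorem lasso [Finite V] [Finite E] [Finite I] (ho : o.IsAcyclic)
    (hbal : ∀ v ∈ G.verts S, o.Balanced S v) (X : Set V) {u : V} (hu : u ∈ G.verts S) (s : ℤˣ) :
    o.Lasso S X u s := by
  obtain ⟨a, haS, rfl, rfl⟩ := (hbal u hu).exists_sign s
  rcases (G.ends (G.edge a)).eq_singleton_or_nontrivial rfl with ha | ha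
  · refine Or.inl ⟨_, figure_of_halfEdge ha haS, fun z hz hzu => ?_⟩
    rw [verts_singleton_of_halfEdge ha] at hz
    exact absurd hz hzu
  · obtain ⟨b, hb, hba⟩ := ha.exists_ne a
    have h : G.edge a = G.edge b := Eq.symm hb
    by_cases hvb : G.vert a = G.vert b
    · refine Or.inl ⟨_, figure_of_loop ho hba.symm h hvb haS, fun z hz hzu => ?_⟩
      rw [verts_singleton_of_link hba.symm h, ← hvb] at hz
      exact absurd (by simpa using hz) hzu
    · have hP : o.DirPath S (G.vert a) (o.τ a) _ _ _ := .single hba.symm h hvb haS rfl rfl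
      have hvert : ∀ z ∈ G.verts {G.edge a}, z = G.vert a ∨ z = G.vert b := fun z hz => by
        rwa [verts_singleton_of_link hba.symm h] at hz
      by_cases hbX : G.vert b ∈ X
      · exact Or.inr (Or.inr ⟨_, _, _, hP, hbX, fun z hz h1 h2 => absurd (hvert z hz) (by tauto)⟩)
      · refine lasso_of_dirPath ho hbal X (Nat.card V + 1) hP (fun z hz hzu => ?_) (by omega)
        rwa [(hvert z hz).resolve_left hzu]

/-! ### Acyclic orientations have positive potentials -/

/-- In an acyclic orientation, every nonempty set of edges has a source or a sink. Otherwise, a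
directed walk yields a figure at some vertex `v`, and a second walk, which leaves `v` with the
opposite sign, completes it to a handcuff or runs into it and closes a positive circle. -/
theorem IsAcyclic.exists_not_balanced [Finite V] [Finite E] [Finite I] (ho : o.IsAcyclic)
    (hS : S.Nonempty) : ∃ v ∈ G.verts S, ¬ o.Balanced S v := by
  by_contra! hbal
  obtain ⟨e, he⟩ := hS
  obtain ⟨a, ha⟩ : (G.ends e).Nonempty := by
    rw [Set.nonempty_iff_ne_empty]
    intro h0
    refine ho {e} ⟨Or.inl ⟨e, rfl, h0⟩, ?_⟩
    rintro v ⟨a, ha, -⟩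
    exact absurd (Set.ext_iff.1 h0 a |>.1 ha) (Set.notMem_empty a)
  have haS : G.edge a ∈ S := (show G.edge a = e from ha) ▸ he
  obtain ⟨C, v, s, hC⟩ : ∃ C v s, o.Figure S C v s := by
    rcases lasso ho hbal ∅ (mem_verts haS) 1 with ⟨C, hC, -⟩ | ⟨P, w, r, C, -, hC, -⟩ |
      ⟨P, w, r, -, hw, -⟩
    · exact ⟨C, _, _, hC⟩
    · exact ⟨C, _, _, hC⟩
    · exact absurd hw (Set.notMem_empty w)
  obtain ⟨c, hcC, hcv⟩ := hC.mem
  have hcs := hC.sign c hcC hcv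
  rcases lasso ho hbal (G.verts C \ {v}) (verts_mono hC.subset hC.mem) (-s) with
    ⟨D, hD, hDX⟩ | ⟨P, w, r, D, hP, hD, hPD, hPX, hDX⟩ | ⟨P, w, r, hP, hw, hPX⟩
  · have hmeet : ∀ z ∈ G.verts C, z ∈ G.verts D → z = v := fun z hz hz' => by
      by_contra hzv
      exact hDX z hz' hzv ⟨hz, hzv⟩
    obtain ⟨d, hdD, hdv⟩ := hD.mem
    have hds := hD.sign d hdD hdv
    have hnonempty : ∀ e ∈ C, ∃ a, G.edge a = e := fun e he => by
      rcases hC.isUnbalancedFigure with ⟨h, -⟩ | ⟨e', rfl, h⟩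
      · obtain ⟨x, y, -, h⟩ := Set.encard_eq_two.1 (h.2.2.1 e he)
        exact ⟨x, (edge_eq_of_ends_eq_pair h).1⟩
      · obtain ⟨x, h⟩ := Set.encard_eq_one.1 h
        rw [Set.mem_singleton_iff.1 he]
        exact ⟨x, edge_eq_of_ends_eq_singleton h⟩
    have hdisj : Disjoint C D := by
      rw [Set.disjoint_left]
      intro e he he'
      obtain ⟨a, rfl⟩ := hnonempty e he
      have hav := hmeet _ (mem_verts he) (mem_verts he')
      exact units_ne_neg s ((hC.sign a he hav).symm.trans (hD.sign a he' hav))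
    refine ho (C ∪ D) ⟨Or.inr (Or.inr (Or.inl ⟨C, D, rfl, hdisj, hC.isUnbalancedFigure,
      hD.isUnbalancedFigure, v, ?_⟩)), ?_⟩
    · exact Set.eq_singleton_iff_unique_mem.2 ⟨⟨hC.mem, hD.mem⟩, fun z hz => hmeet z hz.1 hz.2⟩
    · intro z hz
      change o.Balanced (C ∪ D) z
      by_cases hzv : z = v
      · subst hzv
        exact balanced_of_signs ⟨c, Or.inl hcC, hcv, hcs⟩ ⟨d, Or.inr hdD, hdv, hds⟩
      · rw [verts_union] at hz
        rcases hz with hz | hz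
        · exact (hC.balanced z hz hzv).mono Set.subset_union_left
        · exact (hD.balanced z hz hzv).mono Set.subset_union_right
  · have hvw : v ≠ w := hP.strand.isPath.1
    have hvD : v ∉ G.verts D := fun h => hvw (hPD v hP.strand.left_mem h)
    obtain ⟨d, hdD, hdw⟩ := hD.mem
    have hds := hD.sign d hdD hdw
    obtain ⟨p, -, hpP, hpv, hps⟩ := hP.strand.exists_left
    obtain ⟨q, -, hqP, hqw, hqr⟩ := hP.strand.symm.exists_left
    refine ho (C ∪ D ∪ P) ⟨Or.inr (Or.inr (Or.inr ⟨C, D, P, v, w, rfl, hC.isUnbalancedFigure,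
      hD.isUnbalancedFigure, ?_, hP.strand.isPath, ?_, ?_⟩)), ?_⟩
    · rw [Set.disjoint_left]
      intro z hz hz'
      have hzv : z ≠ v := fun e => hvD (e ▸ hz')
      exact hDX z hz' hzv ⟨hz, hzv⟩
    · refine Set.eq_singleton_iff_unique_mem.2 ⟨⟨hP.strand.left_mem, hC.mem⟩, fun z hz => ?_⟩
      by_contra hzv
      exact hPX z hz.1 hzv ⟨hz.2, hzv⟩
    · exact Set.eq_singleton_iff_unique_mem.2 ⟨⟨hP.strand.right_mem, hD.mem⟩,
        fun z hz => hPD z hz.1 hz.2⟩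
    · intro z hz
      change o.Balanced (C ∪ D ∪ P) z
      by_cases hzv : z = v
      · subst hzv
        exact balanced_of_signs ⟨c, Or.inl (Or.inl hcC), hcv, hcs⟩ ⟨p, Or.inr hpP, hpv, hps⟩
      by_cases hzw : z = w
      · subst hzw
        exact balanced_of_signs ⟨q, Or.inr hqP, hqw, hqr⟩ ⟨d, Or.inl (Or.inr hdD), hdw, hds⟩
      rw [verts_union, verts_union] at hz
      rcases hz with (hz | hz) | hz
      · exact (hC.balanced z hz hzv).mono (Set.subset_union_left.trans Set.subset_union_left)
      · exact (hD.balanced z hz hzw).mono (Set.subset_union_right.trans Set.subset_union_left)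
      · exact (hP.strand.balanced z hz hzv hzw).mono Set.subset_union_right
  · obtain ⟨A, hA, hA'⟩ := hC.arc w hw.1 hw.2 (-r)
    refine hP.strand.not_isAcyclic ((neg_neg s).symm ▸ hA') (fun z hz hz' => ?_) ho
    by_contra! hz''
    exact hPX z hz hz''.1 hz''.2 ⟨verts_mono hA hz', hz''.1⟩

/-- An acyclic orientation has a positive potential, found by deleting a source or sink `v`
together with its edges and then giving `v` a coordinate of large absolute value. -/
theorem IsAcyclic.exists_compat [Finite V] [Finite E] [Finite I] (ho : o.IsAcyclic) :
    ∃ x, o.Compat x := by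
  classical
  have := Fintype.ofFinite V
  suffices h : ∀ (m : ℕ) (S : Set E), S.ncard = m → ∃ x, ∀ e ∈ S, 0 < o.value x e by
    obtain ⟨x, hx⟩ := h _ Set.univ rfl
    exact ⟨x, fun e => hx e trivial⟩
  intro m
  induction m using Nat.strong_induction_on with
  | _ m ih =>
    intro S hm
    rcases S.eq_empty_or_nonempty with rfl | hS
    · exact ⟨0, fun e he => absurd he (Set.notMem_empty e)⟩
    obtain ⟨v, ⟨a, haS, hav⟩, hv⟩ := ho.exists_not_balanced hS
    obtain ⟨s, hs⟩ : ∃ s : ℤˣ, ∀ c, G.edge c ∈ S → G.vert c = v → o.τ c = s := by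
      refine ⟨o.τ a, fun c hc hcv => ?_⟩
      by_contra hne
      exact hv (balanced_of_signs ⟨a, haS, hav, rfl⟩
        ⟨c, hc, hcv, (units_eq_or_eq_neg _ _).resolve_left hne⟩)
    let S' : Set E := {e ∈ S | ∀ c, G.edge c = e → G.vert c ≠ v}
    have hlt : S'.ncard < m := by
      rw [← hm]
      refine Set.ncard_lt_ncard ⟨fun e he => he.1, fun h => ?_⟩
      exact (h haS).2 a rfl hav
    obtain ⟨x, hx⟩ := ih _ hlt S' rfl
    let M : ℤ := 1 + ∑ w, |x w|
    have hM : ∀ (t : ℤˣ) w, -M < t * x w := fun t w => by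
      have h1 : |x w| ≤ ∑ w, |x w| :=
        Finset.single_le_sum (fun w _ => abs_nonneg (x w)) (Finset.mem_univ w)
      have h2 := neg_abs_le (x w)
      have h3 := le_abs_self (x w)
      rcases Int.units_eq_one_or t with rfl | rfl <;> simp [M] <;> omega
    have hM0 : 0 < M := by
      have : 0 ≤ ∑ w, |x w| := Finset.sum_nonneg fun w _ => abs_nonneg _
      omega
    let y : V → ℤ := Function.update x v (s * M)
    have hyv : ∀ c, G.edge c ∈ S → G.vert c = v → (o.τ c : ℤ) * y (G.vert c) = M :=
      fun c hc hcv => by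
        rw [hs c hc hcv, hcv]
        simp [y, ← mul_assoc, ← Units.val_mul]
    have hyM : ∀ c, G.edge c ∈ S → -M < (o.τ c : ℤ) * y (G.vert c) := fun c hc => by
      by_cases hcv : G.vert c = v
      · rw [hyv c hc hcv]
        omega
      · simp only [y, Function.update_of_ne hcv]
        exact hM _ _
    refine ⟨y, fun e he => ?_⟩
    by_cases he' : e ∈ S'
    · have : o.value y e = o.value x e := by
        refine finsum_mem_congr rfl fun c hc => ?_
        simp only [y, Function.update_of_ne (he'.2 c hc)]
      rw [this]
      exact hx e he'
    · obtain ⟨c, rfl, hcv⟩ : ∃ c, G.edge c = e ∧ G.vert c = v := by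
        by_contra! h
        exact he' ⟨he, h⟩
      rcases (G.ends (G.edge c)).eq_singleton_or_nontrivial rfl with h | h
      · rw [value_of_ends_eq_singleton h, hyv c he hcv]
        exact hM0
      · obtain ⟨d, hd, hdc⟩ := h.exists_ne c
        have hcd : G.edge c = G.edge d := Eq.symm hd
        rw [value_of_ends_eq_pair hdc.symm (ends_eq_pair hdc.symm hcd), hyv c he hcv]
        have := hyM d (hcd ▸ he)
        omega

end Orientation

end SignedGraph

/-! ### Proper colorings and positive potentials -/

namespace SignedGraph

variable {V E I : Type*} (G : SignedGraph V E I)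

/-- The amount by which a coloring is proper at the edge of the end `a`: it is `x_i` for a
half-edge at `i`, and `x_i - ε(e) x_j` for an edge with two ends, `a` at `i` and another at `j`. -/
noncomputable def gap (x : V → ℤ) (a : I) : ℤ :=
  x (G.vert a) - G.sign (G.edge a) * ∑ᶠ b ∈ G.ends (G.edge a) \ {a}, x (G.vert b)

variable {G} {x : V → ℤ}

theorem gap_of_halfEdge {a : I} (h : G.ends (G.edge a) = {a}) : G.gap x a = x (G.vert a) := by
  simp [gap, h]

theorem gap_of_link {a b : I} (hab : a ≠ b) (h : G.edge a = G.edge b) :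
    G.gap x a = x (G.vert a) - G.sign (G.edge a) * x (G.vert b) := by
  have : G.ends (G.edge a) \ {a} = {b} := by
    rw [ends_eq_pair hab h]
    ext c
    simp only [Set.mem_sdiff, Set.mem_insert_iff, Set.mem_singleton_iff]
    constructor
    · rintro ⟨rfl | rfl, h⟩
      · exact absurd rfl h
      · rfl
    · rintro rfl
      exact ⟨Or.inr rfl, hab.symm⟩
  rw [gap, this, finsum_mem_singleton]

/-- An end is the only end of its edge, or the edge has exactly one other end. -/
theorem halfEdge_or_link (a : I) :
    G.ends (G.edge a) = {a} ∨ ∃ b, a ≠ b ∧ G.edge a = G.edge b := by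
  rcases (G.ends (G.edge a)).eq_singleton_or_nontrivial rfl with h | h
  · exact Or.inl h
  · obtain ⟨b, hb, hba⟩ := h.exists_ne a
    exact Or.inr ⟨b, hba.symm, Eq.symm hb⟩

theorem gap_symm {a b : I} (hab : a ≠ b) (h : G.edge a = G.edge b) :
    G.gap x b = -G.sign (G.edge a) * G.gap x a := by
  rw [gap_of_link hab h, gap_of_link hab.symm h.symm, ← h]
  have : (G.sign (G.edge a) : ℤ) * G.sign (G.edge a) = 1 := by
    rw [← Units.val_mul, Int.units_mul_self, Units.val_one]
  linear_combination (-x (G.vert b)) * this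

theorem isProper_iff : G.IsProper x ↔
    (∀ e, (G.ends e).Nonempty) ∧ ∀ a, G.gap x a ≠ 0 := by
  refine and_congr_right fun _ => ⟨fun h a => ?_, fun h => ⟨fun a ha => ?_, fun a b hab he => ?_⟩⟩
  · rcases halfEdge_or_link (G := G) a with ha | ⟨b, hab, he⟩
    · rw [gap_of_halfEdge ha]
      exact h.1 a ha
    · rw [gap_of_link hab he, sub_ne_zero]
      exact h.2 a b hab he
  · rw [← gap_of_halfEdge (x := x) ha]
    exact h a
  · rw [← sub_ne_zero, ← gap_of_link hab he]
    exact h a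

namespace Orientation

theorem value_edge (o : G.Orientation) (x : V → ℤ) (a : I) :
    o.value x (G.edge a) = o.τ a * G.gap x a := by
  rcases halfEdge_or_link (G := G) a with ha | ⟨b, hab, he⟩
  · rw [value_of_ends_eq_singleton ha, gap_of_halfEdge ha]
  · rw [value_of_ends_eq_pair hab (ends_eq_pair hab he), gap_of_link hab he,
      o.τ_eq_of_ends_eq_pair hab (ends_eq_pair hab he)]
    push_cast
    ring

variable {o o' : G.Orientation}

theorem Compat.sign_gap (h : o.Compat x) (a : I) :
    SignType.sign (G.gap x a) = SignType.sign (o.τ a : ℤ) := by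
  have := h (G.edge a)
  rw [value_edge] at this
  rcases Int.units_eq_one_or (o.τ a) with h1 | h1
  · rw [h1] at this ⊢
    rw [sign_pos (by simpa using this)]
    rfl
  · rw [h1] at this ⊢
    rw [sign_neg (by simpa using this)]
    rfl

theorem sign_units_injective {s t : ℤˣ}
    (h : SignType.sign (s : ℤ) = SignType.sign (t : ℤ)) : s = t := by
  rcases Int.units_eq_one_or s with rfl | rfl <;> rcases Int.units_eq_one_or t with rfl | rfl <;>
    revert h <;> decide

/-- A potential is positive for at most one orientation. -/
theorem Compat.unique (h : o.Compat x) (h' : o'.Compat x) : o = o' := by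
  ext a
  rw [sign_units_injective ((h.sign_gap a).symm.trans (h'.sign_gap a))]

theorem Compat.isProper (h : o.Compat x) : G.IsProper x := by
  refine isProper_iff.2 ⟨fun e => ?_, fun a ha => ?_⟩
  · rw [Set.nonempty_iff_ne_empty]
    intro he
    have := h e
    rw [value_of_ends_eq_empty he] at this
    exact lt_irrefl _ this
  · have := h (G.edge a)
    rw [value_edge, ha, mul_zero] at this
    exact lt_irrefl _ this

end Orientation

theorem IsProper.exists_compat (h : G.IsProper x) : ∃ o : G.Orientation, o.Compat x := by
  classical
  obtain ⟨hne, h0⟩ := isProper_iff.1 h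
  have hs : ∀ a, ∃ s : ℤˣ, 0 < (s : ℤ) * G.gap x a := fun a => by
    rcases lt_or_gt_of_ne (h0 a) with h1 | h1
    · exact ⟨-1, by simpa using h1⟩
    · exact ⟨1, by simpa using h1⟩
  choose s hs using hs
  refine ⟨⟨s, fun b a hba he => ?_⟩, fun e => ?_⟩
  · have ha := hs a
    have hb := hs b
    rw [gap_symm hba.symm he.symm, ← he] at hb
    rcases Int.units_eq_one_or (s a) with h1 | h1 <;>
      rcases Int.units_eq_one_or (s b) with h2 | h2 <;>
      rcases Int.units_eq_one_or (G.sign (G.edge b)) with h3 | h3 <;>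
      simp only [h1, h2, h3, Units.val_neg, Units.val_one] at ha hb ⊢ <;>
      first | (exfalso; linarith) | simp
  · obtain ⟨a, rfl⟩ := hne e
    rw [Orientation.value_edge]
    exact hs a

end SignedGraph

/-! ### Automorphisms act on acyclic orientations -/

namespace SignedPerm

variable {n : ℕ}

/-- The action of a signed permutation on `ℤⁿ`. -/
noncomputable def act (β : SignedPerm n) (x : Fin n → ℤ) (i : Fin n) : ℤ :=
  β.sgn i * x (β.perm.symm i)

theorem act_one (x : Fin n → ℤ) : act 1 x = x := by
  funext i
  rw [act, sgn_one, Units.val_one, one_mul]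
  rfl

theorem act_mul (β γ : SignedPerm n) (x : Fin n → ℤ) : act (β * γ) x = act β (act γ x) := by
  funext i
  simp only [act, sgn_mul, Units.val_mul, mul_assoc]
  rfl

theorem act_sum (β : SignedPerm n) {ι : Type*} (s : Finset ι) (f : ι → Fin n → ℤ) :
    act β (∑ k ∈ s, f k) = ∑ k ∈ s, act β (f k) := by
  funext i
  simp only [act, Finset.sum_apply, Finset.mul_sum]

end SignedPerm

namespace SignedGraph

variable {n : ℕ} {E I : Type*} {G : SignedGraph (Fin n) E I}

theorem Realizes.ends_eq {β : SignedPerm n} {f : E ≃ E} {g : I ≃ I} (h : G.Realizes β f g)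
    (e : E) : G.ends (f e) = g '' G.ends e := by
  ext a
  constructor
  · intro ha
    refine ⟨g.symm a, ?_, g.apply_symm_apply a⟩
    have h1 := h.edge_eq (g.symm a)
    rw [g.apply_symm_apply] at h1
    exact f.injective (h1.symm.trans ha)
  · rintro ⟨b, hb, rfl⟩
    exact (h.edge_eq b).trans (congrArg f hb)

namespace Orientation

variable {o o' : G.Orientation} {x : Fin n → ℤ}

/-- An automorphism that carries one orientation to another carries the positive potentials of the
first to positive potentials of the second. -/
theorem Compat.map {β : SignedPerm n} {f : E ≃ E} {g : I ≃ I} (h : G.Realizes β f g)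
    (ho : ∀ a, o'.τ (g a) = β.sgn (G.vert (g a)) * o.τ a) (hx : o.Compat x) :
    o'.Compat (β.act x) := by
  intro e
  obtain ⟨e, rfl⟩ := f.surjective e
  have : o'.value (β.act x) (f e) = o.value x e := by
    rw [value, h.ends_eq, finsum_mem_image g.injective.injOn]
    refine finsum_mem_congr rfl fun a _ => ?_
    have h1 : ((β.sgn (G.vert (g a)) : ℤˣ) : ℤ) * β.sgn (G.vert (g a)) = 1 := by
      rw [← Units.val_mul, SignedPerm.sgn_mul_self, Units.val_one]
    have h2 : β.perm.symm (G.vert (g a)) = G.vert a := by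
      rw [h.vert_eq, Equiv.symm_apply_apply]
    rw [ho, SignedPerm.act, h2]
    push_cast
    linear_combination (o.τ a * x (G.vert a)) * h1
  rw [this]
  exact hx e

theorem exists_map {β : SignedPerm n} {f : E ≃ E} {g : I ≃ I} (h : G.Realizes β f g)
    (o : G.Orientation) :
    ∃ o' : G.Orientation, ∀ a, o'.τ (g a) = β.sgn (G.vert (g a)) * o.τ a := by
  refine ⟨⟨fun a => β.sgn (G.vert a) * o.τ (g.symm a), fun a a' haa' he => ?_⟩, fun a => by simp⟩
  obtain ⟨c, rfl⟩ := g.surjective a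
  obtain ⟨c', rfl⟩ := g.surjective a'
  have hcc' : c ≠ c' := fun e => haa' (congrArg g e)
  rw [h.edge_eq, h.edge_eq] at he
  have he' := f.injective he
  have hs := h.sign_eq (G.edge c)
  rw [h.ends_eq, ends_eq_pair hcc' he', finprod_mem_image g.injective.injOn,
    finprod_mem_pair hcc'] at hs
  rw [h.edge_eq, hs, g.symm_apply_apply, g.symm_apply_apply, o.compat c c' hcc' he']
  rcases Int.units_eq_one_or (β.sgn (G.vert (g c'))) with h1 | h1 <;> simp [h1, mul_assoc]

end Orientation

theorem finite_orientation [Finite I] : Finite G.Orientation :=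
  Finite.of_injective (fun o : G.Orientation => o.τ) fun _ _ h => Orientation.ext h

variable [Finite E] [Finite I]

/-- The automorphism `β` carries `o` to `o'`, expressed without a choice of induced bijections of
the edges and the ends: it carries the cone of positive potentials of `o` into that of `o'`. -/
def Carries (β : SignedPerm n) (o o' : G.AcyclicOrientation) : Prop :=
  ∀ x, o.1.Compat x → o'.1.Compat (β.act x)

theorem Carries.unique {β : SignedPerm n} {o o' o'' : G.AcyclicOrientation} (h : Carries β o o')
    (h' : Carries β o o'') : o' = o'' := by
  obtain ⟨x, hx⟩ := o.2.exists_compat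
  exact Subtype.ext ((h x hx).unique (h' x hx))

theorem exists_carries (β : G.autGroup) (o : G.AcyclicOrientation) : ∃ o', Carries β.1 o o' := by
  obtain ⟨f, g, h⟩ := β.2
  obtain ⟨o', ho'⟩ := Orientation.exists_map h o.1
  obtain ⟨x, hx⟩ := o.2.exists_compat
  exact ⟨⟨o', (hx.map h ho').isAcyclic⟩, fun y hy => hy.map h ho'⟩

/-- The action of the automorphism group on acyclic orientations. It is well defined since an
acyclic orientation is determined by any of its positive potentials; in particular, it does not
depend on how an automorphism permutes parallel edges. -/
noncomputable instance : MulAction G.autGroup G.AcyclicOrientation where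
  smul β o := (exists_carries β o).choose
  one_smul o := by
    refine (exists_carries 1 o).choose_spec.unique fun x hx => ?_
    rw [OneMemClass.coe_one, SignedPerm.act_one]
    exact hx
  mul_smul β γ o := by
    refine (exists_carries (β * γ) o).choose_spec.unique fun x hx => ?_
    rw [Subgroup.coe_mul, SignedPerm.act_mul]
    exact (exists_carries β _).choose_spec _ ((exists_carries γ o).choose_spec x hx)

theorem carries_smul (β : G.autGroup) (o : G.AcyclicOrientation) : Carries β.1 o (β • o) :=
  (exists_carries β o).choose_spec

theorem orientationSetoid_iff (o o' : G.AcyclicOrientation) :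
    G.orientationSetoid.r o o' ↔ ∃ β : G.autGroup, β • o = o' := by
  constructor
  · rintro ⟨β, f, g, h, ho⟩
    exact ⟨⟨β, f, g, h⟩, (carries_smul _ o).unique fun x hx => hx.map h ho⟩
  · rintro ⟨β, rfl⟩
    obtain ⟨f, g, h⟩ := β.2
    obtain ⟨o', ho'⟩ := Orientation.exists_map h o.1
    obtain ⟨x, hx⟩ := o.2.exists_compat
    refine ⟨β.1, f, g, h, ?_⟩
    rw [(carries_smul β o x hx).unique (hx.map h ho')]
    exact ho'

/-- An acyclic orientation is fixed by an automorphism if and only if it has a positive potential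
fixed by it: the sum of the images of a positive potential is positive as well. -/
theorem smul_eq_iff (β : G.autGroup) (o : G.AcyclicOrientation) :
    β • o = o ↔ ∃ x, β.1.act x = x ∧ o.1.Compat x := by
  constructor
  · intro h
    obtain ⟨x, hx⟩ := o.2.exists_compat
    have hk : ∀ k : ℕ, o.1.Compat ((β.1 ^ k).act x) := by
      intro k
      induction k with
      | zero =>
        rw [pow_zero, SignedPerm.act_one]
        exact hx
      | succ k ih =>
        rw [pow_succ', SignedPerm.act_mul]
        have := carries_smul β o _ ih
        rwa [h] at this
    have hpos : 0 < orderOf β.1 := orderOf_pos β.1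
    refine ⟨∑ k ∈ Finset.range (orderOf β.1), (β.1 ^ k).act x, ?_, fun e => ?_⟩
    · rw [SignedPerm.act_sum]
      simp only [← SignedPerm.act_mul, ← pow_succ']
      have h1 := Finset.sum_range_succ (fun k => (β.1 ^ k).act x) (orderOf β.1)
      rw [Finset.sum_range_succ', pow_orderOf_eq_one, pow_zero] at h1
      exact add_right_cancel h1
    · have h1 : o.1.value (∑ k ∈ Finset.range (orderOf β.1), (β.1 ^ k).act x) e =
          ∑ k ∈ Finset.range (orderOf β.1), o.1.value ((β.1 ^ k).act x) e := by
        simp only [Orientation.value, Finset.sum_apply, Finset.mul_sum,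
          finsum_mem_eq_finite_toFinset_sum _ (Realizes.finite_ends (G := G) e)]
        exact Finset.sum_comm
      rw [h1]
      exact Finset.sum_pos (fun k _ => hk k e) (Finset.nonempty_range_iff.2 hpos.ne')
  · rintro ⟨x, hx, hc⟩
    have := carries_smul β o x hc
    rw [hx] at this
    exact Subtype.ext (this.unique hc)

end SignedGraph

/-! ### The fixed space of a signed permutation -/

namespace SignedPerm

variable {n : ℕ} (β : SignedPerm n)

/-- The smallest positive exponent that takes `k` to `i`. -/
noncomputable def hit (k i : Fin n) : ℕ := sInf {l : ℕ | 0 < l ∧ (β.perm ^ l) k = i}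

/-- The product of the signs of `β` at `b k, …, b^l k`. -/
noncomputable def pathSign (k : Fin n) (l : ℕ) : ℤˣ :=
  ∏ t ∈ Finset.range l, β.sgn ((β.perm ^ (t + 1)) k)

/-- The sign `(-1)^{β_(i)}`. -/
noncomputable def cycleSign (i : Fin n) : ℤˣ := (-1) ^ β.cycleIndex i

/-- The cycle of `i` meets the switching set in an even number of elements, so that it is a vertex
of the quotient. -/
def IsEven (i : Fin n) : Prop := Even {j | j ∈ β.switch ∧ β.cycleOf j = β.cycleOf i}.ncard

variable {β}

theorem cycleOf_eq_iff {i j : Fin n} : β.cycleOf i = β.cycleOf j ↔ β.perm.SameCycle i j :=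
  Quotient.eq (r := Equiv.Perm.SameCycle.setoid β.perm)

theorem hit_spec {k i : Fin n} (h : β.perm.SameCycle k i) :
    0 < β.hit k i ∧ (β.perm ^ β.hit k i) k = i :=
  Nat.sInf_mem (s := {l : ℕ | 0 < l ∧ (β.perm ^ l) k = i})
    (by obtain ⟨l, hl, -, h⟩ := h.exists_pow_eq''; exact ⟨l, hl, h⟩)

theorem hit_le {k i : Fin n} {l : ℕ} (hl : 0 < l) (h : (β.perm ^ l) k = i) : β.hit k i ≤ l :=
  Nat.sInf_le ⟨hl, h⟩

theorem pow_ne_pow_of_lt_hit {k i : Fin n} (h : β.perm.SameCycle k i) {t u : ℕ} (ht : 1 ≤ t)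
    (htu : t < u) (hu : u ≤ β.hit k i) : (β.perm ^ t) k ≠ (β.perm ^ u) k := by
  intro he
  have h1 : (β.perm ^ (β.hit k i - u + t)) k = i := by
    rw [pow_add, Equiv.Perm.mul_apply, he, ← Equiv.Perm.mul_apply, ← pow_add,
      Nat.sub_add_cancel hu, (hit_spec h).2]
  have := hit_le (by omega) h1
  omega

theorem neg_one_pow_ncard (k : Fin n) (l : ℕ)
    (h : ∀ t u, 1 ≤ t → t < u → u ≤ l → (β.perm ^ t) k ≠ (β.perm ^ u) k) :
    (-1 : ℤˣ) ^ (β.switch ∩ {j | ∃ t, 1 ≤ t ∧ t ≤ l ∧ (β.perm ^ t) k = j}).ncard =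
      β.pathSign k l := by
  induction l with
  | zero =>
    have : {j | ∃ t, 1 ≤ t ∧ t ≤ 0 ∧ (β.perm ^ t) k = j} = ∅ := by
      ext j
      simp only [Set.mem_ofPred_eq, Set.mem_empty_iff_false, iff_false]
      rintro ⟨t, h1, h2, -⟩
      omega
    rw [this]
    simp [pathSign]
  | succ l ih =>
    have hset : {j | ∃ t, 1 ≤ t ∧ t ≤ l + 1 ∧ (β.perm ^ t) k = j} =
        insert ((β.perm ^ (l + 1)) k) {j | ∃ t, 1 ≤ t ∧ t ≤ l ∧ (β.perm ^ t) k = j} := by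
      ext j
      constructor
      · rintro ⟨t, h1, h2, rfl⟩
        rcases Nat.lt_or_eq_of_le h2 with h2 | rfl
        · exact Or.inr ⟨t, h1, by omega, rfl⟩
        · exact Or.inl rfl
      · rintro (rfl | ⟨t, h1, h2, rfl⟩)
        · exact ⟨l + 1, by omega, le_rfl, rfl⟩
        · exact ⟨t, h1, by omega, rfl⟩
    have hnot : (β.perm ^ (l + 1)) k ∉ {j | ∃ t, 1 ≤ t ∧ t ≤ l ∧ (β.perm ^ t) k = j} := by
      rintro ⟨t, h1, h2, h3⟩
      exact h t (l + 1) h1 (by omega) le_rfl h3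
    have ih' := ih fun t u h1 h2 h3 => h t u h1 h2 (by omega)
    rw [pathSign, Finset.prod_range_succ, ← pathSign, ← ih', hset]
    by_cases hs : (β.perm ^ (l + 1)) k ∈ β.switch
    · rw [Set.inter_insert_of_mem hs, Set.ncard_insert_of_notMem fun h => hnot h.2, pow_succ]
      simp [sgn, hs]
    · rw [Set.inter_insert_of_notMem hs]
      simp [sgn, hs]

theorem sameCycle_cycleMin (i : Fin n) : β.perm.SameCycle (β.cycleMin i) i := by
  classical
  unfold cycleMin
  exact (Finset.mem_filter.1 (Finset.min'_mem
    (Finset.univ.filter fun j => β.perm.SameCycle j i) _)).2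

theorem cycleMin_eq {i j : Fin n} (h : β.perm.SameCycle i j) : β.cycleMin i = β.cycleMin j := by
  classical
  unfold cycleMin
  congr 1
  ext k
  simp only [Finset.mem_filter, Finset.mem_univ, true_and]
  exact ⟨fun h' => h'.trans h, fun h' => h'.trans h.symm⟩

theorem cycleSign_eq (i : Fin n) :
    β.cycleSign i = β.pathSign (β.cycleMin i) (β.hit (β.cycleMin i) i) :=
  neg_one_pow_ncard _ _ fun _ _ h1 h2 h3 => pow_ne_pow_of_lt_hit (sameCycle_cycleMin i) h1 h2 h3

theorem isEven_iff {i j : Fin n} (h : β.perm.SameCycle i j) : β.IsEven i ↔ β.IsEven j := by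
  rw [IsEven, IsEven, cycleOf_eq_iff.2 h]

theorem cycleIndex_cycleMin (i : Fin n) :
    β.cycleIndex (β.cycleMin i) = {j | j ∈ β.switch ∧ β.cycleOf j = β.cycleOf i}.ncard := by
  rw [cycleIndex, cycleMin_eq (sameCycle_cycleMin i)]
  congr 1
  set k := β.cycleMin i
  ext j
  refine and_congr_right fun _ => ⟨?_, fun hj => ?_⟩
  · rintro ⟨t, -, -, rfl⟩
    refine cycleOf_eq_iff.2 (Equiv.Perm.SameCycle.trans ?_ (sameCycle_cycleMin i))
    exact (Equiv.Perm.sameCycle_pow_left (n := t)).2 (Equiv.Perm.SameCycle.refl _ _)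
  · have hkj : β.perm.SameCycle k j :=
      (sameCycle_cycleMin i).trans (cycleOf_eq_iff.1 hj).symm
    obtain ⟨h1, h2⟩ := hit_spec hkj
    obtain ⟨h3, h4⟩ := hit_spec (Equiv.Perm.SameCycle.refl β.perm k)
    refine ⟨β.hit k j, h1, ?_, h2⟩
    change β.hit k j ≤ β.hit k k
    by_contra! hlt
    -- otherwise a full turn around the cycle could be left out
    have h5 : (β.perm ^ (β.hit k j - β.hit k k)) k = j := by
      have h6 : (β.perm ^ (β.hit k j - β.hit k k + β.hit k k)) k = j := by
        rw [Nat.sub_add_cancel hlt.le, h2]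
      rwa [pow_add, Equiv.Perm.mul_apply, h4] at h6
    have := hit_le (by omega) h5
    omega

theorem cycleSign_apply {i : Fin n} (h : β.IsEven i) :
    β.cycleSign (β.perm i) = β.sgn (β.perm i) * β.cycleSign i := by
  have hi : β.perm.SameCycle (β.perm i) i :=
    Equiv.Perm.sameCycle_apply_left.2 (Equiv.Perm.SameCycle.refl _ _)
  rw [cycleSign_eq, cycleSign_eq, cycleMin_eq hi]
  have hk := sameCycle_cycleMin (β := β) i
  have hone : β.cycleSign (β.cycleMin i) = 1 := by
    rw [cycleSign, cycleIndex_cycleMin]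
    exact Even.neg_one_pow h
  rw [cycleSign_eq, cycleMin_eq hk] at hone
  set k := β.cycleMin i
  obtain ⟨h1, h2⟩ := hit_spec hk
  obtain ⟨h3, h4⟩ := hit_spec (hk.trans hi.symm)
  have hsucc : (β.perm ^ (β.hit k i + 1)) k = β.perm i := by
    rw [pow_succ', Equiv.Perm.mul_apply, h2]
  have hle := hit_le (by omega) hsucc
  rcases Nat.lt_or_eq_of_le hle with hlt | heq
  · obtain ⟨m, hm⟩ : ∃ m, β.hit k (β.perm i) = m + 1 := ⟨_, (Nat.sub_add_cancel h3).symm⟩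
    rw [hm, pow_succ', Equiv.Perm.mul_apply] at h4
    have h5 := β.perm.injective h4
    have hm0 : m = 0 := by
      by_contra h0
      have := hit_le (Nat.pos_of_ne_zero h0) h5
      omega
    subst hm0
    have hik : k = i := by simpa using h5
    rw [hm, ← hik, hone, pathSign]
    simp
  · rw [heq, pathSign, Finset.prod_range_succ, ← pathSign, hsucc, mul_comm]

theorem apply_of_act_eq {x : Fin n → ℤ} (hx : β.act x = x) (i : Fin n) :
    x (β.perm i) = β.sgn (β.perm i) * x i := by
  conv_lhs => rw [← hx]
  simp [act]

theorem pow_apply_of_act_eq {x : Fin n → ℤ} (hx : β.act x = x) (k : Fin n) (l : ℕ) :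
    x ((β.perm ^ l) k) = β.pathSign k l * x k := by
  induction l with
  | zero => simp [pathSign]
  | succ l ih =>
    rw [pow_succ', Equiv.Perm.mul_apply, apply_of_act_eq hx, ih, pathSign, pathSign,
      Finset.prod_range_succ, pow_succ', Equiv.Perm.mul_apply]
    push_cast
    ring

theorem eq_cycleSign_mul {x : Fin n → ℤ} (hx : β.act x = x) (i : Fin n) :
    x i = β.cycleSign i * x (β.cycleMin i) := by
  rw [cycleSign_eq, ← pow_apply_of_act_eq hx, (hit_spec (sameCycle_cycleMin i)).2]

theorem eq_zero_of_not_isEven {x : Fin n → ℤ} (hx : β.act x = x) {i : Fin n}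
    (h : ¬ β.IsEven i) : x i = 0 := by
  have h1 := eq_cycleSign_mul hx (β.cycleMin i)
  have h2 : β.cycleSign (β.cycleMin i) = -1 := by
    rw [cycleSign, cycleIndex_cycleMin]
    exact Odd.neg_one_pow (Nat.not_even_iff_odd.1 h)
  rw [h2, cycleMin_eq (sameCycle_cycleMin i)] at h1
  have h3 : x (β.cycleMin i) = 0 := by
    push_cast at h1
    linarith
  rw [eq_cycleSign_mul hx i, h3, mul_zero]

variable (β)

/-- The coordinate `i` of a point of the fixed space of `β`, as a literal over the vertices of the
quotient. -/
noncomputable def literal (i : Fin n) : Literal β.EvenCycle := by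
  classical exact if h : β.IsEven i then some (⟨β.cycleOf i, h⟩, β.cycleSign i) else none

/-- The parametrization of the fixed space of `β` by the functions on the vertices of the
quotient. -/
noncomputable def unfold (y : β.EvenCycle → ℤ) (i : Fin n) : ℤ := (β.literal i).eval y

variable {β}

theorem unfold_of_isEven (y : β.EvenCycle → ℤ) {i : Fin n} (h : β.IsEven i) :
    β.unfold y i = β.cycleSign i * y ⟨β.cycleOf i, h⟩ := by
  simp [unfold, literal, h, Literal.eval]

theorem unfold_of_not_isEven (y : β.EvenCycle → ℤ) {i : Fin n} (h : ¬ β.IsEven i) :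
    β.unfold y i = 0 := by
  simp [unfold, literal, h, Literal.eval]

theorem act_eq_iff (x : Fin n → ℤ) : β.act x = x ↔ ∃ y, x = β.unfold y := by
  constructor
  · intro hx
    refine ⟨fun s => x (β.cycleMin s.1.out), funext fun i => ?_⟩
    by_cases h : β.IsEven i
    · rw [unfold_of_isEven _ h, eq_cycleSign_mul hx]
      have : β.perm.SameCycle (β.cycleOf i).out i := cycleOf_eq_iff.1 (Quotient.out_eq _)
      rw [cycleMin_eq this]
    · rw [unfold_of_not_isEven _ h, eq_zero_of_not_isEven hx h]
  · rintro ⟨y, rfl⟩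
    funext i
    obtain ⟨j, rfl⟩ := β.perm.surjective i
    have hj : β.perm.SameCycle (β.perm j) j :=
      Equiv.Perm.sameCycle_apply_left.2 (Equiv.Perm.SameCycle.refl _ _)
    rw [act, Equiv.symm_apply_apply]
    by_cases h : β.IsEven j
    · have h' := (isEven_iff hj).2 h
      rw [unfold_of_isEven _ h, unfold_of_isEven _ h', cycleSign_apply h]
      have : (⟨β.cycleOf (β.perm j), h'⟩ : β.EvenCycle) = ⟨β.cycleOf j, h⟩ :=
        Subtype.ext (cycleOf_eq_iff.2 hj)
      rw [this]
      push_cast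
      ring
    · rw [unfold_of_not_isEven _ h, unfold_of_not_isEven _ (mt (isEven_iff hj).1 h), mul_zero]

end SignedPerm

/-! ### Colorings of the quotient -/

namespace SignedGraph

open SignedPerm

variable {n : ℕ} {E I : Type*} {G : SignedGraph (Fin n) E I} {β : SignedPerm n}

theorem unfold_eq_zero_iff {y : β.EvenCycle → ℤ} {i : Fin n} (h : β.IsEven i) :
    β.unfold y i = 0 ↔ y ⟨β.cycleOf i, h⟩ = 0 := by
  rw [unfold_of_isEven y h]
  simp

theorem quotient_sign_of_link {a b : I} (hab : a ≠ b) (h : G.edge a = G.edge b)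
    (ha : β.IsEven (G.vert a)) (hb : β.IsEven (G.vert b)) :
    (G.quotient β).sign (G.edge a) =
      G.sign (G.edge a) * (β.cycleSign (G.vert a) * β.cycleSign (G.vert b)) := by
  have h1 : ¬ ∃ c ∈ G.ends (G.edge a),
      ¬ Even {i | i ∈ β.switch ∧ β.cycleOf i = β.cycleOf (G.vert c)}.ncard := by
    rintro ⟨c, hc, hc'⟩
    rcases eq_or_eq_of_edge_eq hab h hc with rfl | rfl
    · exact hc' ha
    · exact hc' hb
  simp only [quotient]
  rw [if_neg h1, if_pos (encard_ends_of_link hab h), ends_eq_pair hab h, finprod_mem_pair hab]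
  rfl

/-- A coloring of the quotient is proper if and only if the corresponding point of the fixed space
is a proper coloring of the signed graph. -/
theorem quotient_isProper_iff (y : β.EvenCycle → ℤ) :
    (G.quotient β).IsProper y ↔ G.IsProper (β.unfold y) := by
  have hsq : ∀ s : ℤˣ, (s : ℤ) * s = 1 := fun s => by
    rw [← Units.val_mul, Int.units_mul_self, Units.val_one]
  -- the condition at an edge both ends of which remain is multiplied by a sign
  have link : ∀ (a b : I) (ha : β.IsEven (G.vert a)) (hb : β.IsEven (G.vert b)), a ≠ b →
      G.edge a = G.edge b → (β.unfold y (G.vert a) = G.sign (G.edge a) * β.unfold y (G.vert b) ↔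
        y ⟨β.cycleOf (G.vert a), ha⟩ =
          (G.quotient β).sign (G.edge a) * y ⟨β.cycleOf (G.vert b), hb⟩) := by
    intro a b ha hb hab he
    rw [quotient_sign_of_link hab he ha hb, unfold_of_isEven y ha, unfold_of_isEven y hb]
    push_cast
    have h1 := hsq (β.cycleSign (G.vert a))
    constructor
    · intro h
      linear_combination (β.cycleSign (G.vert a) : ℤ) * h - y ⟨β.cycleOf (G.vert a), ha⟩ * h1
    · intro h
      linear_combination (β.cycleSign (G.vert a) : ℤ) * h + ((G.sign (G.edge a) : ℤ) *
        β.cycleSign (G.vert b) * y ⟨β.cycleOf (G.vert b), hb⟩) * h1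
  constructor
  · rintro ⟨hne, hhalf, hlink⟩
    -- an end whose partner is deleted has a nonzero color
    have half : ∀ (a : I) (ha : β.IsEven (G.vert a)),
        (∀ b, b ≠ a → G.edge b = G.edge a → ¬ β.IsEven (G.vert b)) →
        β.unfold y (G.vert a) ≠ 0 := by
      intro a ha h
      rw [Ne, unfold_eq_zero_iff ha]
      refine hhalf ⟨a, ha⟩ (Set.eq_singleton_iff_unique_mem.2 ⟨rfl, fun b hb => ?_⟩)
      by_contra hba
      exact h b.1 (fun e => hba (Subtype.ext e)) hb b.2
    refine ⟨fun e => ?_, fun a ha => ?_, fun a b hab he h => ?_⟩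
    · obtain ⟨a, ha⟩ := hne e
      exact ⟨a.1, ha⟩
    · obtain ⟨c, hc⟩ := hne (G.edge a)
      have hca : c.1 = a := (Set.ext_iff.1 ha c.1).1 hc
      exact half a (hca ▸ c.2) fun b hba hb => absurd ((Set.ext_iff.1 ha b).1 hb) hba
    · by_cases ha : β.IsEven (G.vert a)
      · by_cases hb : β.IsEven (G.vert b)
        · exact hlink ⟨a, ha⟩ ⟨b, hb⟩ (fun e => hab (congrArg Subtype.val e)) he
            ((link a b ha hb hab he).1 h)
        · rw [unfold_of_not_isEven y hb, mul_zero] at h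
          refine half a ha (fun c hca hc => ?_) h
          rwa [(eq_or_eq_of_edge_eq hab he hc).resolve_left hca]
      · rw [unfold_of_not_isEven y ha] at h
        have hb : β.IsEven (G.vert b) := by
          obtain ⟨c, hc⟩ := hne (G.edge a)
          rcases eq_or_eq_of_edge_eq hab he (show G.edge c.1 = _ from hc) with h1 | h1
          · exact absurd (h1 ▸ c.2) ha
          · exact h1 ▸ c.2
        refine half b hb (fun c hcb hc => ?_) (by simpa using h.symm)
        rwa [(eq_or_eq_of_edge_eq hab he (hc.trans he.symm)).resolve_right hcb]
  · rintro ⟨hne, hhalf, hlink⟩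
    refine ⟨fun e => ?_, fun a ha => ?_, fun a b hab he => ?_⟩
    · obtain ⟨a, rfl⟩ := hne e
      by_cases ha : β.IsEven (G.vert a)
      · exact ⟨⟨a, ha⟩, rfl⟩
      rcases halfEdge_or_link (G := G) a with h | ⟨b, hab, he⟩
      · exact absurd (unfold_of_not_isEven y ha) (hhalf a h)
      · by_cases hb : β.IsEven (G.vert b)
        · exact ⟨⟨b, hb⟩, he.symm⟩
        · refine absurd ?_ (hlink a b hab he)
          rw [unfold_of_not_isEven y ha, unfold_of_not_isEven y hb, mul_zero]
    · change y ⟨β.cycleOf (G.vert a.1), a.2⟩ ≠ 0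
      refine fun h0 => (?_ : β.unfold y (G.vert a.1) ≠ 0) ((unfold_eq_zero_iff a.2).2 h0)
      rcases halfEdge_or_link (G := G) a.1 with h | ⟨b, hab, he⟩
      · exact hhalf a.1 h
      · have hb : ¬ β.IsEven (G.vert b) := fun hb =>
          hab (congrArg Subtype.val ((Set.ext_iff.1 ha ⟨b, hb⟩).1 he.symm)).symm
        have := hlink a.1 b hab he
        rwa [unfold_of_not_isEven y hb, mul_zero] at this
    · have hab' : a.1 ≠ b.1 := fun e => hab (Subtype.ext e)
      exact fun h => hlink a.1 b.1 hab' he ((link a.1 b.1 a.2 b.2 hab' he).2 h)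

/-! ### Fixed acyclic orientations as regions -/

/-- The properness of the coloring `unfold y` at the edge `e` says that a form does not vanish
at `y`. -/
theorem exists_litForm (G : SignedGraph (Fin n) E I) (β : SignedPerm n) (e : E) :
    ∃ F : LitForm β.EvenCycle, (G.ends e = ∅ ∧ ∀ y, F.eval y = 0) ∨
      ∃ a, G.edge a = e ∧ ∀ y, F.eval y = G.gap (β.unfold y) a := by
  rcases (G.ends e).eq_empty_or_nonempty with h | ⟨a, rfl⟩
  · exact ⟨(none, none), Or.inl ⟨h, fun y => rfl⟩⟩
  rcases halfEdge_or_link (G := G) a with h | ⟨b, hab, he⟩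
  · refine ⟨(β.literal (G.vert a), none), Or.inr ⟨a, rfl, fun y => ?_⟩⟩
    rw [gap_of_halfEdge h]
    exact add_zero _
  · refine ⟨(β.literal (G.vert a), (β.literal (G.vert b)).scale (-G.sign (G.edge a))),
      Or.inr ⟨a, rfl, fun y => ?_⟩⟩
    rw [gap_of_link hab he, LitForm.eval, Literal.eval_scale, SignedPerm.unfold, SignedPerm.unfold]
    push_cast
    ring

variable [Finite E] [Finite I]

instance : Finite β.EvenCycle := Subtype.finite

instance : Finite G.AcyclicOrientation :=
  have := finite_orientation (G := G)
  Subtype.finite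

/-- The chromatic polynomial of a quotient exists, and its value at `-1` is, up to sign, the number
of acyclic orientations that the automorphism fixes: these correspond to the regions into which the
fixed space is cut by the hyperplanes of the edges. -/
theorem quotient_chromaticPolynomial (β : G.autGroup) :
    (∀ k : ℕ, (G.quotient β).chromaticPolynomial.eval (k : ℚ) =
      (G.quotient β).numProperColorings k) ∧
    (G.quotient β).chromaticPolynomial.eval (-1) = (-1) ^ Nat.card (β : SignedPerm n).EvenCycle *
      (Nat.card (MulAction.fixedBy G.AcyclicOrientation β) : ℚ) := by
  classical
  have := Fintype.ofFinite E
  choose F hF using exists_litForm G β.1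
  let L : List (LitForm (β : SignedPerm n).EvenCycle) := Finset.univ.toList.map F
  have hgeneric : ∀ y, G.IsProper ((β : SignedPerm n).unfold y) ↔ LitForm.Generic L y := by
    intro y
    have h1 : LitForm.Generic L y ↔ ∀ e, (F e).eval y ≠ 0 := by
      simp [LitForm.Generic, L]
    rw [h1]
    constructor
    · intro h e
      rcases hF e with ⟨he, -⟩ | ⟨a, -, hy⟩
      · exact absurd he (h.1 e).ne_empty
      · rw [hy]
        exact (isProper_iff.1 h).2 a
    · intro h
      refine isProper_iff.2 ⟨fun e => ?_, fun a h0 => ?_⟩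
      · rcases hF e with ⟨-, he⟩ | ⟨a, ha, -⟩
        · exact absurd (he y) (h e)
        · exact ⟨a, ha⟩
      · rcases hF (G.edge a) with ⟨-, he⟩ | ⟨b, hb, hy⟩
        · exact h _ (he y)
        · refine h (G.edge a) ?_
          rw [hy]
          by_cases hab : a = b
          · rw [← hab, h0]
          · rw [gap_symm hab hb.symm, h0, mul_zero]
  obtain ⟨P, hP, hP1⟩ := LitForm.exists_polynomial _ _ L rfl
  have hPG : ∀ k : ℕ, P.eval (k : ℚ) = (G.quotient β).numProperColorings k := by
    intro k
    rw [hP, LitForm.numGeneric, numProperColorings]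
    congr 1
    refine Nat.card_congr (Equiv.subtypeEquivRight fun y => ?_)
    rw [quotient_isProper_iff, hgeneric]
  have hex : ∃ p : ℚ[X], ∀ k : ℕ, p.eval (k : ℚ) = (G.quotient β).numProperColorings k := ⟨P, hPG⟩
  have hspec : ∀ k : ℕ, (G.quotient β).chromaticPolynomial.eval (k : ℚ) =
      (G.quotient β).numProperColorings k := by
    rw [chromaticPolynomial, dif_pos hex]
    exact hex.choose_spec
  have hPeq : (G.quotient β).chromaticPolynomial = P := by
    refine eq_of_infinite_eval_eq _ _ ((Set.infinite_range_of_injective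
      (Nat.cast_injective (R := ℚ))).mono ?_)
    rintro _ ⟨k, rfl⟩
    exact (hspec k).trans (hPG k).symm
  refine ⟨hspec, ?_⟩
  rw [hPeq, hP1]
  congr 2
  -- the sign vectors of `L` determine the fixed acyclic orientations, and conversely
  have hfix : ∀ o : MulAction.fixedBy G.AcyclicOrientation β,
      ∃ y, o.1.1.Compat ((β : SignedPerm n).unfold y) := fun o => by
    obtain ⟨x, hx, hc⟩ := (smul_eq_iff β o.1).1 o.2
    obtain ⟨y, rfl⟩ := (act_eq_iff x).1 hx
    exact ⟨y, hc⟩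
  choose Y hY using hfix
  have hsign : ∀ (o : G.Orientation) y y', o.Compat ((β : SignedPerm n).unfold y) →
      o.Compat ((β : SignedPerm n).unfold y') →
      ∀ e, SignType.sign ((F e).eval y) = SignType.sign ((F e).eval y') := by
    intro o y y' h h' e
    rcases hF e with ⟨-, he⟩ | ⟨a, -, hy⟩
    · rw [he, he]
    · rw [hy, hy, h.sign_gap, h'.sign_gap]
  symm
  refine Nat.card_congr (Equiv.ofBijective (fun o => (⟨L.map fun F => SignType.sign (F.eval (Y o)),
    Y o, (hgeneric _).1 (hY o).isProper, rfl⟩ : LitForm.regions L)) ⟨fun o o' h => ?_, ?_⟩)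
  · have h1 : ∀ e, SignType.sign ((F e).eval (Y o)) = SignType.sign ((F e).eval (Y o')) := by
      have := List.map_inj_left.1 (congrArg Subtype.val h)
      exact fun e => this (F e) (List.mem_map_of_mem (by simp))
    refine Subtype.ext (Subtype.ext (Orientation.ext (funext fun a => ?_)))
    rcases hF (G.edge a) with ⟨he, -⟩ | ⟨b, hb, hy⟩
    · exact absurd (Set.ext_iff.1 he a |>.1 rfl) (Set.notMem_empty a)
    · have h2 := h1 (G.edge a)
      rw [hy, hy, (hY o).sign_gap, (hY o').sign_gap] at h2
      have h3 := Orientation.sign_units_injective h2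
      by_cases hab : a = b
      · rw [hab, h3]
      · rw [o.1.1.compat a b hab hb.symm, o'.1.1.compat a b hab hb.symm, h3]
  · rintro ⟨_, y, hy, rfl⟩
    obtain ⟨o, ho⟩ := ((hgeneric y).2 hy).exists_compat
    let o' : G.AcyclicOrientation := ⟨o, ho.isAcyclic⟩
    have hfixed : β • o' = o' :=
      (smul_eq_iff β o').2 ⟨_, (act_eq_iff _).2 ⟨y, rfl⟩, ho⟩
    refine ⟨⟨_, hfixed⟩, Subtype.ext ?_⟩
    refine List.map_congr_left fun F' hF' => ?_
    obtain ⟨e, -, rfl⟩ := List.mem_map.1 hF'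
    exact hsign o _ _ (hY ⟨_, hfixed⟩) ho e

end SignedGraph

open Classical in
theorem theorem4p2 {n : ℕ} {E I : Type*} [Finite E] [Finite I] (G : SignedGraph (Fin n) E I) :
    (∀ (β : G.autGroup) (k : ℕ), (G.quotient β).chromaticPolynomial.eval (k : ℚ) =
      (G.quotient β).numProperColorings k) ∧
    (Nat.card G.UnlabeledAcyclicOrientation : ℚ) =
      1 / (Nat.card G.autGroup : ℚ) * ∑ β : G.autGroup,
        (-1 : ℚ) ^ Nat.card (β : SignedPerm n).EvenCycle *
          (G.quotient β).chromaticPolynomial.eval (-1) := by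
  refine ⟨fun β => (SignedGraph.quotient_chromaticPolynomial β).1, ?_⟩
  have := Fintype.ofFinite G.AcyclicOrientation
  have hsetoid : G.orientationSetoid = MulAction.orbitRel G.autGroup G.AcyclicOrientation := by
    ext o o'
    rw [MulAction.orbitRel_apply, MulAction.mem_orbit_symm]
    exact SignedGraph.orientationSetoid_iff o o'
  have hcard : Nat.card G.UnlabeledAcyclicOrientation =
      Nat.card (MulAction.orbitRel.Quotient G.autGroup G.AcyclicOrientation) := by
    rw [SignedGraph.UnlabeledAcyclicOrientation, hsetoid]
  have hburnside := MulAction.sum_card_fixedBy_eq_card_orbits_mul_card_group G.autGroup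
    G.AcyclicOrientation
  have hB : (Nat.card G.autGroup : ℚ) ≠ 0 := Nat.cast_ne_zero.2 Nat.card_pos.ne'
  have hsum : ∑ β : G.autGroup, (-1 : ℚ) ^ Nat.card (β : SignedPerm n).EvenCycle *
      (G.quotient β).chromaticPolynomial.eval (-1) =
        Nat.card G.UnlabeledAcyclicOrientation * Nat.card G.autGroup := by
    rw [hcard, Nat.card_eq_fintype_card, Nat.card_eq_fintype_card, ← Nat.cast_mul]
    refine Eq.trans ?_ (congrArg Nat.cast hburnside)
    rw [Nat.cast_sum]
    refine Finset.sum_congr rfl fun β _ => ?_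
    rw [(SignedGraph.quotient_chromaticPolynomial β).2, ← mul_assoc, ← mul_pow, neg_one_mul,
      neg_neg, one_pow, one_mul, Nat.card_eq_fintype_card]
  rw [hsum]
  field_simp
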